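/- **Cauchy's Integral Formula.** Let $p$ be an odd prime, $\mathbb{C}_p$ the completion of an algebraic closure of $\mathbb{Q}_p$, and write $D^{+}(c,\rho)$, $D^{-}(c,\rho)$ for the closed and open discs with centre $c$ and radius $\rho>0$ in $\mathbb{C}_p$. For $a\neq b$ in $\mathbb{C}_p$ the *arc* $\mathcal{A}(a,b)$ is the open disc $D^{-}(b,|b-a|_p)$, regarded as a part of the circle $\{x : |x-a|_p=|b-a|_p\}$. For an integer $\alpha\ge 0$ let $\Phi_\alpha$ be the family of sequences $\varphi(k)=\alpha+\lambda k$, $\lambda=1,2,\dots$. For $g:\mathcal{A}(a,b)\to\mathbb{C}_p$ one writes $\int_{\mathcal{A}(a,b),\Phi_\alpha} g(x)\,dx=L$ if for every $\varepsilon>0$ there are $\varphi\in\Phi_\alpha$ and $K$ such that for all $k>K$ $$\Bigl|\,p^{-\varphi(k)}\sum_{\zeta^{p^{\varphi(k)}}=1}(x_\zeta-a)\,g(x_\zeta)-L\Bigr|_p<\varepsilon,\qquad x_\zeta=a+(b-a)\zeta ;$$ such an $L$ is unique if it exists. A function on a set $\mathcal{D}\subseteq\mathbb{C}_p$ is *Krasner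 analytic on $\mathcal{D}$* if it is a uniform limit on $\mathcal{D}$ of rational functions without poles in $\mathcal{D}$. Let $\mathcal{C}$ be a circle with centre $a$ and radius $R>0$, let $1\le m\le M$, and let $$\mathcal{D}=D^{+}(a,R)\setminus\bigcup_{i=1}^{M}D^{-}(x_i,r_i),\qquad r_i=R\ (i\le m),\quad 0<r_i<R\ (m<i\le M).$$ Suppose that $|a-x_i|_p=R$ for $i\le m$, that the discs $D^{-}(x_i,r_i)$ are mutually disjoint, and that the discs $D^{+}(x_i,r_i)$, $i>m$, are mutually disjoint. Let $b$ be a point on $\mathcal{C}$ with $|b-x_i|_p=R$ for all $i$. For each $i$ let $b_i$ be a point with $|b_i-x_i|_p=r_i$, such that for $1\le i\le m$: $|b_i-x_j|_p=R$ for all $j$, $|b_i-b_j|_p=R$ for all $j\neq i$, and $|b_i-b|_p=R$. Let $\alpha\ge 0$ be an integer. Let $\bar x\in\mathcal{D}$ be such that $$|\bar x-b|_p=R,\qquad |\bar x-b_i|_p=R\ \ (1\le i\le m),\qquad |\bar x-x_i|_p>r_i\ \ (i>m),$$ and put $r^{*}=\min_{1\le i\le M}|\bar x-x_i|_p$, $\mathcal{D}^{*}=D^{-}(\bar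 x,r^{*})$. Then there are constants $\mu_0,\mu_1,\dots,\mu_M\in\mathbb{C}_p$, depending only on $\alpha$, $\mathcal{D}^{*}$, the region $\mathcal{D}$ with its boundary circle $\mathcal{C}$, and the arcs $\mathcal{A}(a,b)$ and $\mathcal{A}(x_i,b_i)$ (each arc together with the circle it lies on), such that for every $z\in\mathcal{D}^{*}$ and every Krasner analytic function $f$ on $\mathcal{D}$ the following integrals exist and $$f(z)=\mu_0\int_{\mathcal{A}(a,b),\Phi_\alpha}\frac{f(x)}{x-z}\,dx+\sum_{i=1}^{M}\mu_i\int_{\mathcal{A}(x_i,b_i),\Phi_\alpha}\frac{f(x)}{x-z}\,dx .$$ -/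

import Mathlib

namespace PadicLine

/-- The mean `A_{f,φ}(k)` at level `n = φ k`: `p⁻ⁿ ∑ (x - a) f x`, where `x = a + (b - a) ζ` and
`ζ` runs through the `pⁿ`-th roots of unity. All these points `x` lie in the arc `A(a, b)`. -/
noncomputable def arcMean {p : ℕ} [Fact p.Prime] (f : ℂ_[p] → ℂ_[p]) (a b : ℂ_[p]) (n : ℕ) :
    ℂ_[p] :=
  ((p : ℂ_[p]) ^ n)⁻¹ *
    ∑ ζ ∈ Polynomial.nthRootsFinset (p ^ n) (1 : ℂ_[p]),
      ((a + (b - a) * ζ) - a) * f (a + (b - a) * ζ)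

/-- `HasLineIntegral Φ a b f L` says that the line integral of `f` over the arc `A(a, b)` with
respect to the family of path sequences `Φ` exists and equals `L`. -/
def HasLineIntegral {p : ℕ} [Fact p.Prime] (Φ : Set (ℕ → ℕ)) (a b : ℂ_[p])
    (f : ℂ_[p] → ℂ_[p]) (L : ℂ_[p]) : Prop :=
  ∀ ε : ℝ, 0 < ε → ∃ φ ∈ Φ, ∃ K : ℕ, ∀ k : ℕ, K < k → ‖arcMean f a b (φ k) - L‖ < ε

/-- The interlocked family `Φ_α` of path sequences `k ↦ α + λ k`, `λ = 1, 2, …`. -/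
def pathFamily (α : ℕ) : Set (ℕ → ℕ) :=
  {φ | ∃ l : ℕ, 1 ≤ l ∧ ∀ k : ℕ, φ k = α + l * k}

/-- The value of the line integral with respect to `Φ_α` is unique. -/
theorem HasLineIntegral.unique {p : ℕ} [Fact p.Prime] {α : ℕ} {a b : ℂ_[p]}
    {f : ℂ_[p] → ℂ_[p]} {L L' : ℂ_[p]} (h : HasLineIntegral (pathFamily α) a b f L)
    (h' : HasLineIntegral (pathFamily α) a b f L') : L = L' := by
  by_contra hne
  have hε : 0 < ‖L - L'‖ / 2 := by
    have := norm_pos_iff.mpr (sub_ne_zero.mpr hne)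
    positivity
  obtain ⟨φ, ⟨l, hl, hφ⟩, K, hK⟩ := h _ hε
  obtain ⟨ψ, ⟨l', hl', hψ⟩, K', hK'⟩ := h' _ hε
  have h1 := hK (l' * (K + K' + 1)) (by nlinarith)
  have h2 := hK' (l * (K + K' + 1)) (by nlinarith)
  rw [hφ] at h1
  rw [hψ, show α + l' * (l * (K + K' + 1)) = α + l * (l' * (K + K' + 1)) by ring] at h2
  set A := arcMean f a b (α + l * (l' * (K + K' + 1)))
  have h3 : ‖L - L'‖ ≤ ‖A - L‖ + ‖A - L'‖ := by
    calc ‖L - L'‖ = ‖(A - L') - (A - L)‖ := by congr 1; ring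
      _ ≤ ‖A - L'‖ + ‖A - L‖ := norm_sub_le _ _
      _ = _ := add_comm _ _
  linarith

/-- `f` is Krasner analytic on `D`: a uniform limit on `D` of rational functions without poles
in `D`. (The values of `f` outside `D` play no role.) -/
def IsKrasnerAnalyticOn {p : ℕ} [Fact p.Prime] (f : ℂ_[p] → ℂ_[p]) (D : Set ℂ_[p]) : Prop :=
  ∃ P Q : ℕ → Polynomial ℂ_[p],
    (∀ n, ∀ x ∈ D, (Q n).eval x ≠ 0) ∧
    TendstoUniformlyOn (fun n x => (P n).eval x / (Q n).eval x) f Filter.atTop D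

/-- An arc as a geometric object: a circle together with the arc as a set of points of it. -/
structure Arc (p : ℕ) [Fact p.Prime] where
  /-- the circle on which the arc lies -/
  circle : Set ℂ_[p]
  /-- the points of the arc -/
  carrier : Set ℂ_[p]

/-- The arc `A(a, b)`: on the circle with centre `a` through `b`, of radius `R = |b - a|`, the
points `x` with `|x - b| < R`. -/
def arc {p : ℕ} [Fact p.Prime] (a b : ℂ_[p]) : Arc p where
  circle := Metric.sphere a ‖b - a‖
  carrier := Metric.ball b ‖b - a‖

/-- The closed disc `D⁺(a, R)` with the open holes `D⁻(x i, r i)` removed. -/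
def holedDisc {p M : ℕ} [Fact p.Prime] (a : ℂ_[p]) (R : ℝ) (x : Fin M → ℂ_[p])
    (r : Fin M → ℝ) : Set ℂ_[p] :=
  Metric.closedBall a R \ ⋃ i, Metric.ball (x i) (r i)

end PadicLine

/-!
For `u = (c - a) / (b - a)` the mean of `1 / (y - c)` over the `pⁿ`-th roots of unity on the arc
`A(a, b)` is `1 / (1 - u ^ pⁿ)` (`arcMean_one_div_sub`). If `c` is not on the arc, this converges
along the family `Φ_α`: trivially if `‖u‖ ≠ 1`, and if `‖u‖ = 1` because the residue field of
`ℂ_[p]` is algebraic over `𝔽_p`, so that some `u ^ p ^ l` lies in the residue class of `u`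
(`exists_tendsto_pow_prime_pow`). The limit `arcLimit α u` depends on the residue class of `u` only;
it is `1` for `‖u‖ < 1`, it is `0` for `‖u‖ > 1`, and modulo the maximal ideal it is the `α`-fold
Frobenius of `1 / (1 - u)`.

The means of a Krasner analytic function on the disc of an arc are bounded by its supremum uniformly
in `n`, although they contain the factor `p⁻ⁿ` (`norm_arcMean_le`). Hence line integrals pass to
uniform limits, and a linear combination of line integrals that kills `1 / (y - c)` for every `c`
outside the domain kills all rational functions with poles outside the domain: multiple poles are
uniform limits of distinct simple ones (`hasArcSum_rational`). Writing
`f y / (y - z) = (f y - f z) / (y - z) + f z / (y - z)`, where the first summand has no pole at `z`,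
one sees that the Cauchy formula holds as soon as the combination kills `1 / (y - c)` for `c`
outside the domain and has the value `1` on `1 / (y - z)` (`hasArcSum_cauchy`).

Since `arcLimit` is constant on each hole and on `D*`, and vanishes for `c` outside the big disc,
these are `M + 1` linear equations for the `M + 1` coefficients. The arcs of the holes of radius
smaller than `R` see the pole in their own hole only, so the matrix is block triangular with an
identity block; the block of the arcs of radius `R` is modulo the maximal ideal a Frobenius twist of
the Cauchy matrix `(b j - a j) / (b j - c i)`, whose determinant is not zero because the `b j` and
the `c i` lie in different residue classes (`det_arcLimit_ne_zero`). The equations depend on the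
discs and the arcs as sets only, which makes the coefficients functions of these sets
(`IsCauchyConfig.isSolution_congr`).
-/

namespace PadicLine

open Filter Topology Polynomial

variable {p : ℕ} [Fact p.Prime]

/-! ### The filter of an interlocked family of paths -/

/-- The filter on levels generated by the tails of the progressions `k ↦ α + l k`, `l ≥ 1`.
Convergence of the means along this filter is existence of the line integral. -/
noncomputable def pathFilter (α : ℕ) : Filter ℕ :=
  ⨅ l : ℕ+, map (fun k : ℕ => α + (l : ℕ) * k) atTop

theorem pathFilter_le_map (α : ℕ) {l : ℕ} (hl : 1 ≤ l) :
    pathFilter α ≤ map (fun k : ℕ => α + l * k) atTop :=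
  iInf_le (fun l : ℕ+ => map (fun k : ℕ => α + (l : ℕ) * k) atTop) ⟨l, hl⟩

theorem pathFilter_le_atTop (α : ℕ) : pathFilter α ≤ atTop :=
  (pathFilter_le_map α le_rfl).trans <| tendsto_atTop_mono (fun k => by simp) tendsto_id

theorem directed_progressions (α : ℕ) :
    Directed (· ≥ ·) (fun l : ℕ+ => map (fun k : ℕ => α + (l : ℕ) * k) atTop) := by
  have key : ∀ l l' : ℕ+, map (fun k : ℕ => α + ((l * l' : ℕ+) : ℕ) * k) atTop ≤
      map (fun k : ℕ => α + (l : ℕ) * k) atTop := by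
    intro l l'
    have : (fun k : ℕ => α + ((l * l' : ℕ+) : ℕ) * k) =
        (fun k : ℕ => α + (l : ℕ) * k) ∘ fun k => (l' : ℕ) * k := by
      funext k
      simp [mul_assoc]
    rw [this, ← map_map]
    exact map_mono <| tendsto_atTop_mono (fun k => Nat.le_mul_of_pos_left k l'.pos) tendsto_id
  intro l l'
  exact ⟨l * l', key l l', by simpa only [mul_comm l l'] using key l' l⟩

instance (α : ℕ) : (pathFilter α).NeBot :=
  iInf_neBot_of_directed' (directed_progressions α) fun _ => inferInstance

theorem hasLineIntegral_of_tendsto {α : ℕ} {a b L : ℂ_[p]}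
    {f : ℂ_[p] → ℂ_[p]} (h : Tendsto (arcMean f a b) (pathFilter α) (𝓝 L)) :
    HasLineIntegral (pathFamily α) a b f L := by
  intro ε hε
  have h1 : ∀ᶠ n in pathFilter α, ‖arcMean f a b n - L‖ < ε := by
    simpa only [dist_eq_norm] using (Metric.tendsto_nhds.mp h) ε hε
  obtain ⟨l, hl⟩ := (mem_iInf_of_directed (directed_progressions α) _).mp h1
  obtain ⟨K, hK⟩ := mem_atTop_sets.mp (mem_map.mp hl)
  exact ⟨fun k => α + l * k, ⟨l, l.pos, fun _ => rfl⟩, K, fun k hk => hK k hk.le⟩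

/-! ### Sums over roots of unity -/

theorem mem_nthRootsFinset_iff {N : ℕ} (hN : 0 < N) {ζ : ℂ_[p]} :
    ζ ∈ nthRootsFinset N (1 : ℂ_[p]) ↔ ζ ^ N = 1 := mem_nthRootsFinset hN 1

theorem exists_primitiveRoot {N : ℕ} (hN : 0 < N) : ∃ η : ℂ_[p], IsPrimitiveRoot η N := by
  have : NeZero (N : ℂ_[p]) := ⟨by exact_mod_cast hN.ne'⟩
  exact HasEnoughRootsOfUnity.exists_primitiveRoot ℂ_[p] N

theorem card_nthRootsFinset {N : ℕ} (hN : 0 < N) :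
    (nthRootsFinset N (1 : ℂ_[p])).card = N := by
  obtain ⟨η, hη⟩ := exists_primitiveRoot (p := p) hN
  exact hη.card_nthRootsFinset

theorem sum_nthRoots_pow {N : ℕ} (hN : 0 < N) (j : ℕ) :
    ∑ ζ ∈ nthRootsFinset N (1 : ℂ_[p]), ζ ^ j = if N ∣ j then (N : ℂ_[p]) else 0 := by
  split_ifs with h
  · obtain ⟨d, rfl⟩ := h
    rw [Finset.sum_congr rfl (g := fun _ => 1), Finset.sum_const, card_nthRootsFinset hN]
    · simp
    · intro ζ hζ
      rw [pow_mul, (mem_nthRootsFinset_iff hN).mp hζ, one_pow]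
  · obtain ⟨η, hη⟩ := exists_primitiveRoot (p := p) hN
    have hη0 : η ≠ 0 := hη.ne_zero hN.ne'
    have hne : η ^ j ≠ 1 := fun h1 => h (hη.dvd_of_pow_eq_one j h1)
    have hS : ∑ ζ ∈ nthRootsFinset N (1 : ℂ_[p]), ζ ^ j =
        η ^ j * ∑ ζ ∈ nthRootsFinset N (1 : ℂ_[p]), ζ ^ j := by
      rw [Finset.mul_sum]
      refine Finset.sum_bij' (fun ζ _ => η⁻¹ * ζ) (fun ζ _ => η * ζ) ?_ ?_ ?_ ?_ ?_
      · intro ζ hζ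
        rw [mem_nthRootsFinset_iff hN] at hζ ⊢
        rw [mul_pow, inv_pow, hη.pow_eq_one, hζ]; simp
      · intro ζ hζ
        rw [mem_nthRootsFinset_iff hN] at hζ ⊢
        rw [mul_pow, hη.pow_eq_one, hζ]; simp
      · intro ζ _; field_simp
      · intro ζ _; field_simp
      · intro ζ _; rw [← mul_pow]; congr 1; field_simp
    have : (1 - η ^ j) * ∑ ζ ∈ nthRootsFinset N (1 : ℂ_[p]), ζ ^ j = 0 := by
      rw [sub_mul, one_mul, ← hS, sub_self]
    exact (mul_eq_zero.mp this).resolve_left (sub_ne_zero.mpr hne.symm)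

/-- Averaging over the `N`-th roots of unity extracts coefficients: the mean of `ζ ^ j * H ζ` is
the sum of the coefficients of `H` whose index is `≡ -j` modulo `N`. -/
theorem mean_pow_mul_eval {N : ℕ} (hN : 0 < N) (j : ℕ) (H : ℂ_[p][X]) :
    (N : ℂ_[p])⁻¹ * ∑ ζ ∈ nthRootsFinset N (1 : ℂ_[p]), ζ ^ j * H.eval ζ =
      ∑ i ∈ Finset.range (H.natDegree + 1), if N ∣ j + i then H.coeff i else 0 := by
  have hN0 : (N : ℂ_[p]) ≠ 0 := by exact_mod_cast hN.ne'
  simp_rw [eval_eq_sum_range, Finset.mul_sum]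
  rw [Finset.sum_comm]
  refine Finset.sum_congr rfl fun i _ => ?_
  have : ∀ ζ : ℂ_[p], (N : ℂ_[p])⁻¹ * (ζ ^ j * (H.coeff i * ζ ^ i)) =
      ((N : ℂ_[p])⁻¹ * H.coeff i) * ζ ^ (j + i) := fun ζ => by rw [pow_add]; ring
  simp_rw [this]
  rw [← Finset.mul_sum, sum_nthRoots_pow hN]
  split_ifs
  · field_simp
  · simp

theorem geom_sum_root_of_unity {N : ℕ} {ζ u : ℂ_[p]} (hζ : ζ ^ N = 1) :
    (∑ j ∈ Finset.range N, ζ ^ j * u ^ (N - 1 - j)) * (ζ - u) = 1 - u ^ N := by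
  rw [(Commute.all ζ u).geom_sum₂_mul, hζ]

theorem sum_nthRoots_div_sub {N : ℕ} (hN : 0 < N) {u : ℂ_[p]} (hu : u ^ N ≠ 1) :
    ∑ ζ ∈ nthRootsFinset N (1 : ℂ_[p]), ζ / (ζ - u) = N * (1 / (1 - u ^ N)) := by
  have hu' : 1 - u ^ N ≠ 0 := sub_ne_zero.mpr hu.symm
  have h1 : ∀ ζ ∈ nthRootsFinset N (1 : ℂ_[p]), ζ / (ζ - u) =
      (∑ j ∈ Finset.range N, ζ ^ (j + 1) * u ^ (N - 1 - j)) * (1 / (1 - u ^ N)) := by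
    intro ζ hζ
    have hζ := (mem_nthRootsFinset_iff hN).mp hζ
    have h2 := geom_sum_root_of_unity (u := u) hζ
    have h3 : ζ - u ≠ 0 := fun h => hu' (by rw [← h2, h, mul_zero])
    have h4 : ∑ j ∈ Finset.range N, ζ ^ (j + 1) * u ^ (N - 1 - j) =
        ζ * ∑ j ∈ Finset.range N, ζ ^ j * u ^ (N - 1 - j) := by
      rw [Finset.mul_sum]
      exact Finset.sum_congr rfl fun j _ => by ring
    rw [h4, ← h2]
    have h5 : ∑ j ∈ Finset.range N, ζ ^ j * u ^ (N - 1 - j) ≠ 0 := fun h =>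
      hu' (by rw [← h2, h, zero_mul])
    field_simp
  rw [Finset.sum_congr rfl h1, ← Finset.sum_mul, Finset.sum_comm]
  congr 1
  obtain ⟨M, rfl⟩ : ∃ M, N = M + 1 := ⟨N - 1, by omega⟩
  simp_rw [← Finset.sum_mul, sum_nthRoots_pow hN]
  rw [Finset.sum_eq_single_of_mem M (by simp)]
  · simp
  · intro j hj hne
    have : ¬ (M + 1 ∣ j + 1) := fun h => by
      have := Nat.le_of_dvd (by omega) h
      have := Finset.mem_range.mp hj
      omega
    rw [if_neg this, zero_mul]

/-! ### Means of functions over an arc -/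

theorem prime_pow_pos (n : ℕ) : 0 < p ^ n := pow_pos (Fact.out : p.Prime).pos n

theorem arcMean_eq (f : ℂ_[p] → ℂ_[p]) (a b : ℂ_[p]) (n : ℕ) :
    arcMean f a b n = (b - a) * (((p ^ n : ℕ) : ℂ_[p])⁻¹ *
      ∑ ζ ∈ nthRootsFinset (p ^ n) (1 : ℂ_[p]), ζ * f (a + (b - a) * ζ)) := by
  rw [arcMean, Nat.cast_pow, mul_left_comm, Finset.mul_sum (a := b - a)]
  congr 1
  exact Finset.sum_congr rfl fun ζ _ => by ring

theorem arcMean_add (f g : ℂ_[p] → ℂ_[p]) (a b : ℂ_[p]) (n : ℕ) :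
    arcMean (fun y => f y + g y) a b n = arcMean f a b n + arcMean g a b n := by
  simp only [arcMean_eq, mul_add, Finset.sum_add_distrib]

theorem arcMean_const_mul (s : ℂ_[p]) (f : ℂ_[p] → ℂ_[p]) (a b : ℂ_[p]) (n : ℕ) :
    arcMean (fun y => s * f y) a b n = s * arcMean f a b n := by
  simp only [arcMean_eq, Finset.mul_sum]
  exact Finset.sum_congr rfl fun ζ _ => by ring

theorem arcMean_sub (f g : ℂ_[p] → ℂ_[p]) (a b : ℂ_[p]) (n : ℕ) :
    arcMean (fun y => f y - g y) a b n = arcMean f a b n - arcMean g a b n := by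
  simp only [arcMean_eq, mul_sub, Finset.sum_sub_distrib]

/-- The mean of `1 / (y - c)` is `1 / (1 - u ^ pⁿ)` with `u = (c - a) / (b - a)`. -/
theorem arcMean_one_div_sub {a b c : ℂ_[p]} (hab : b - a ≠ 0) (n : ℕ)
    (hu : ((c - a) / (b - a)) ^ p ^ n ≠ 1) :
    arcMean (fun y => 1 / (y - c)) a b n = 1 / (1 - ((c - a) / (b - a)) ^ p ^ n) := by
  have hq : ((p ^ n : ℕ) : ℂ_[p]) ≠ 0 := by exact_mod_cast (prime_pow_pos n).ne'
  rw [arcMean_eq]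
  have h1 : ∀ ζ ∈ nthRootsFinset (p ^ n) (1 : ℂ_[p]), ζ * (1 / (a + (b - a) * ζ - c)) =
      (b - a)⁻¹ * (ζ / (ζ - (c - a) / (b - a))) := by
    intro ζ _
    have : a + (b - a) * ζ - c = (b - a) * (ζ - (c - a) / (b - a)) := by
      field_simp; ring
    rw [this, mul_one_div, div_eq_mul_inv, mul_inv, div_eq_mul_inv]; ring
  rw [Finset.sum_congr rfl h1, ← Finset.mul_sum, sum_nthRoots_div_sub (prime_pow_pos n) hu]
  field_simp

theorem tendsto_arcMean_polynomial (α : ℕ) (P : ℂ_[p][X]) (a b : ℂ_[p]) :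
    Tendsto (arcMean (fun y => P.eval y) a b) (pathFilter α) (𝓝 0) := by
  refine Tendsto.congr' ?_ tendsto_const_nhds
  set H := P.comp (C a + C (b - a) * X) with hH
  filter_upwards [pathFilter_le_atTop α (Ici_mem_atTop (H.natDegree + 2))] with n hn
  have h1 : ∀ ζ : ℂ_[p], ζ * P.eval (a + (b - a) * ζ) = ζ ^ 1 * H.eval ζ := by
    intro ζ; simp [hH]
  simp_rw [arcMean_eq, h1]
  rw [mean_pow_mul_eval (prime_pow_pos n), Finset.sum_eq_zero, mul_zero]
  intro i hi
  have h2 : n < p ^ n := Nat.lt_pow_self (Fact.out : p.Prime).one_lt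
  rw [if_neg]
  intro h
  have := Nat.le_of_dvd (by omega) h
  have := Finset.mem_range.mp hi
  have : H.natDegree + 2 ≤ n := hn
  omega

/-! ### Norms of natural numbers -/

theorem norm_natCast_prime : ‖(p : ℂ_[p])‖ = (p : ℝ)⁻¹ := by
  rw [← PadicComplex.coe_natCast, PadicComplex.norm_extends,
    ← map_natCast (algebraMap ℚ_[p] (PadicAlgCl p)), PadicAlgCl.norm_extends, Padic.norm_p]

theorem norm_prime_lt_one : ‖(p : ℂ_[p])‖ < 1 := by
  rw [norm_natCast_prime]
  exact inv_lt_one_of_one_lt₀ (by exact_mod_cast (Fact.out : p.Prime).one_lt)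

theorem norm_prime_pos : 0 < ‖(p : ℂ_[p])‖ := by
  rw [norm_natCast_prime]
  exact inv_pos.mpr (by exact_mod_cast (Fact.out : p.Prime).pos)

theorem norm_natCast_eq_one_of_not_dvd {m : ℕ} (hm : ¬ p ∣ m) : ‖(m : ℂ_[p])‖ = 1 := by
  rw [← PadicComplex.coe_natCast, PadicComplex.norm_extends,
    ← map_natCast (algebraMap ℚ_[p] (PadicAlgCl p)), PadicAlgCl.norm_extends]
  exact Padic.norm_natCast_eq_one_iff.mpr
    (((Fact.out : p.Prime).coprime_iff_not_dvd).mpr hm)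

/-! ### The residue field -/

theorem norm_sub_le_max (x y : ℂ_[p]) : ‖x - y‖ ≤ max ‖x‖ ‖y‖ :=
  by simpa [sub_eq_add_neg] using IsUltrametricDist.norm_add_le_max x (-y)

theorem norm_eq_of_norm_sub_lt {x y : ℂ_[p]} (h : ‖x - y‖ < ‖y‖) : ‖x‖ = ‖y‖ := by
  have := IsUltrametricDist.norm_add_eq_max_of_norm_ne_norm h.ne
  rwa [sub_add_cancel, max_eq_right h.le] at this

/-- The ring of integers of `ℂ_[p]`, cut out by the norm. -/
noncomputable abbrev integerRing (p : ℕ) [Fact p.Prime] : ValuationSubring ℂ_[p] :=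
  (NormedField.valuation (K := ℂ_[p])).valuationSubring

theorem mem_integerRing {x : ℂ_[p]} : x ∈ integerRing p ↔ ‖x‖ ≤ 1 := by
  rw [Valuation.mem_valuationSubring_iff, NormedField.valuation_apply, ← NNReal.coe_le_coe]
  simp

/-- The residue field of `ℂ_[p]`. -/
noncomputable abbrev residueField (p : ℕ) [Fact p.Prime] : Type :=
  IsLocalRing.ResidueField (integerRing p)

/-- Reduction of integers of `ℂ_[p]` modulo the maximal ideal. -/
noncomputable abbrev red : integerRing p →+* residueField p := IsLocalRing.residue (integerRing p)

theorem red_eq_zero_iff (x : integerRing p) : red x = 0 ↔ ‖(x : ℂ_[p])‖ < 1 := by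
  have hx := mem_integerRing.mp x.2
  rw [IsLocalRing.residue_eq_zero_iff, IsLocalRing.mem_maximalIdeal, mem_nonunits_iff,
    ← not_iff_not, not_not, not_lt]
  constructor
  · rintro ⟨u, rfl⟩
    have h1 : ((u : integerRing p) : ℂ_[p]) * ((u⁻¹ : (integerRing p)ˣ) : integerRing p) = 1 := by
      exact_mod_cast congrArg Subtype.val u.mul_inv
    have h2 := congrArg norm h1
    rw [norm_mul, norm_one] at h2
    have h3 := mem_integerRing.mp ((u⁻¹ : (integerRing p)ˣ) : integerRing p).2
    nlinarith [norm_nonneg ((u : integerRing p) : ℂ_[p])]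
  · intro h
    have h1 : ‖(x : ℂ_[p])‖ = 1 := le_antisymm hx h
    have h0 : (x : ℂ_[p]) ≠ 0 := norm_pos_iff.mp (by rw [h1]; exact one_pos)
    refine IsUnit.of_mul_eq_one ⟨(x : ℂ_[p])⁻¹, mem_integerRing.mpr (by simp [h1])⟩ ?_
    ext
    simp [h0]

theorem red_eq_red_iff (x y : integerRing p) : red x = red y ↔ ‖(x : ℂ_[p]) - y‖ < 1 := by
  rw [← sub_eq_zero, ← map_sub, red_eq_zero_iff]
  rfl

instance : CharP (residueField p) p := by
  refine (CharP.charP_iff_prime_eq_zero (Fact.out : p.Prime)).mpr ?_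
  have h : red (p : integerRing p) = 0 := (red_eq_zero_iff _).mpr (by
    simpa using norm_prime_lt_one)
  rwa [map_natCast] at h

/-- In characteristic `p`, an element algebraic over the prime field is fixed by a power of the
Frobenius. -/
theorem exists_pow_eq_self_of_isIntegral {k : Type*} [Field k] [Algebra (ZMod p) k] {x : k}
    (hx : IsIntegral (ZMod p) x) : ∃ l, 1 ≤ l ∧ x ^ p ^ l = x := by
  let L := IntermediateField.adjoin (ZMod p) {x}
  have : FiniteDimensional (ZMod p) L := IntermediateField.adjoin.finiteDimensional hx
  have : Finite L := Module.finite_of_finite (ZMod p)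
  have : Fintype L := Fintype.ofFinite L
  refine ⟨Module.finrank (ZMod p) L, Module.finrank_pos, ?_⟩
  have h1 : Fintype.card L = p ^ Module.finrank (ZMod p) L := by
    rw [Module.card_eq_pow_finrank (K := ZMod p), ZMod.card]
  have h2 := FiniteField.pow_card (⟨x, IntermediateField.mem_adjoin_simple_self _ x⟩ : L)
  rw [h1] at h2
  exact congrArg Subtype.val h2

theorem norm_algebraMap_padic (x : ℚ_[p]) : ‖algebraMap ℚ_[p] ℂ_[p] x‖ = ‖x‖ :=
  PadicComplex.norm_extends' p x

/-- The canonical map from the `p`-adic integers to the integers of `ℂ_[p]`. -/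
noncomputable def padicIntToInteger : ℤ_[p] →+* integerRing p :=
  ((algebraMap ℚ_[p] ℂ_[p]).comp PadicInt.Coe.ringHom).codRestrict (integerRing p).toSubring
    fun x => mem_integerRing.mpr <| by
      rw [RingHom.comp_apply, norm_algebraMap_padic]
      exact PadicInt.norm_le_one x

theorem norm_padicIntToInteger (x : ℤ_[p]) : ‖(padicIntToInteger x : ℂ_[p])‖ = ‖x‖ :=
  norm_algebraMap_padic (x : ℚ_[p])

theorem red_padicIntToInteger [Algebra (ZMod p) (residueField p)] (x : ℤ_[p]) :
    red (padicIntToInteger x) = algebraMap (ZMod p) (residueField p) (PadicInt.toZMod x) := by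
  obtain ⟨m, -, hm⟩ := PadicInt.exists_mem_range x
  have h1 : red (padicIntToInteger (x - (m : ℤ_[p]))) = 0 := by
    rw [red_eq_zero_iff, norm_padicIntToInteger]
    exact PadicInt.mem_nonunits.mp ((IsLocalRing.mem_maximalIdeal _).mp hm)
  have h2 : PadicInt.toZMod (x - (m : ℤ_[p])) = 0 := by
    rw [← RingHom.mem_ker, PadicInt.ker_toZMod]
    exact hm
  simp only [map_sub, map_natCast, sub_eq_zero] at h1 h2
  rw [h1, h2, map_natCast]

/-- The residue field of `ℂ_[p]` is algebraic over the prime field: algebraic numbers are dense,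
and the minimal polynomial of an algebraic number of norm `≤ 1` has `p`-adic integer
coefficients. -/
theorem isIntegral_residueField [Algebra (ZMod p) (residueField p)] (x : residueField p) :
    IsIntegral (ZMod p) x := by
  obtain ⟨x, rfl⟩ := IsLocalRing.residue_surjective x
  obtain ⟨w, hw⟩ := Metric.denseRange_iff.mp
    (UniformSpace.Completion.denseRange_coe (α := PadicAlgCl p)) (x : ℂ_[p]) 1 one_pos
  rw [dist_eq_norm] at hw
  have hwC : ‖(w : ℂ_[p])‖ ≤ 1 := by
    have := norm_sub_le_max (x : ℂ_[p]) ((x : ℂ_[p]) - w)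
    rw [sub_sub_cancel] at this
    exact this.trans (max_le (mem_integerRing.mp x.2) hw.le)
  set w' : integerRing p := ⟨(w : ℂ_[p]), mem_integerRing.mpr hwC⟩ with hw'
  have hred : red x = red w' := (red_eq_red_iff _ _).mpr hw
  change IsIntegral (ZMod p) (red x)
  rw [hred]
  have hint : IsIntegral ℚ_[p] w := Algebra.IsIntegral.isIntegral w
  have hcoeff : ∀ n, ‖(minpoly ℚ_[p] w).coeff n‖ ≤ 1 := by
    refine (spectralValue_le_one_iff (minpoly.monic hint)).mp ?_
    have h1 : ‖w‖ ≤ 1 := by rwa [PadicComplex.norm_extends] at hwC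
    exact h1
  have hlift : minpoly ℚ_[p] w ∈ lifts (PadicInt.Coe.ringHom (p := p)) :=
    (lifts_iff_coeff_lifts _).mpr fun n => ⟨⟨_, hcoeff n⟩, rfl⟩
  obtain ⟨Q, hQ, -, hmon⟩ := lifts_and_natDegree_eq_and_monic hlift (minpoly.monic hint)
  have h0 : eval₂ padicIntToInteger w' Q = 0 := by
    apply Subtype.val_injective
    change (integerRing p).subtype _ = 0
    rw [hom_eval₂]
    have h1 : (integerRing p).subtype.comp padicIntToInteger =
      ((algebraMap (PadicAlgCl p) ℂ_[p]).comp (algebraMap ℚ_[p] (PadicAlgCl p))).comp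
        PadicInt.Coe.ringHom := rfl
    have h2 : (integerRing p).subtype w' = algebraMap (PadicAlgCl p) ℂ_[p] w := rfl
    rw [h1, h2, ← eval₂_map, hQ, ← hom_eval₂]
    have h3 : eval₂ (algebraMap ℚ_[p] (PadicAlgCl p)) w (minpoly ℚ_[p] w) = 0 :=
      minpoly.aeval ℚ_[p] w
    rw [h3, map_zero]
  refine ⟨Q.map PadicInt.toZMod, hmon.map _, ?_⟩
  have h1 : red.comp padicIntToInteger =
      (algebraMap (ZMod p) (residueField p)).comp PadicInt.toZMod :=
    RingHom.ext red_padicIntToInteger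
  rw [eval₂_map, ← h1, ← hom_eval₂, h0, map_zero]

theorem exists_norm_pow_sub_lt {u : ℂ_[p]} (hu : ‖u‖ ≤ 1) :
    ∃ l, 1 ≤ l ∧ ‖u ^ p ^ l - u‖ < 1 := by
  let _ : Algebra (ZMod p) (residueField p) := ZMod.algebra _ p
  let u' : integerRing p := ⟨u, mem_integerRing.mpr hu⟩
  obtain ⟨l, hl, h⟩ := exists_pow_eq_self_of_isIntegral (isIntegral_residueField (red u'))
  refine ⟨l, hl, ?_⟩
  rw [← map_pow, red_eq_red_iff] at h
  exact h

/-! ### Iterated `p`-th powers -/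

/-- Outside the open unit disc about `1`, the numbers `1 - u ^ pⁿ` are as large as possible. -/
theorem norm_one_sub_pow {u : ℂ_[p]} (hu : 1 ≤ ‖u - 1‖) (n : ℕ) :
    ‖1 - u ^ p ^ n‖ = max 1 ‖u‖ ^ p ^ n := by
  rcases le_or_gt ‖u‖ 1 with h | h
  · rw [max_eq_left h, one_pow]
    let u' : integerRing p := ⟨u, mem_integerRing.mpr h⟩
    have h1 : red (1 - u' ^ p ^ n) = (1 - red u') ^ p ^ n := by
      rw [sub_pow_char_pow]; simp
    have h2 : ¬ ‖1 - u ^ p ^ n‖ < 1 := by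
      intro hlt
      have h3 : red (1 - u' ^ p ^ n) = 0 := (red_eq_zero_iff _).mpr hlt
      rw [h1] at h3
      have h4 := eq_zero_of_pow_eq_zero h3
      rw [← map_one red, ← map_sub, red_eq_zero_iff] at h4
      have h5 : ‖1 - u‖ < 1 := h4
      rw [norm_sub_rev] at h5
      exact absurd h5 hu.not_gt
    refine le_antisymm ?_ (not_lt.mp h2)
    refine (norm_sub_le_max _ _).trans (max_le norm_one.le ?_)
    rw [norm_pow]
    exact pow_le_one₀ (norm_nonneg _) h
  · rw [max_eq_right h.le, ← norm_pow, norm_sub_rev]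
    refine norm_eq_of_norm_sub_lt ?_
    rw [show u ^ p ^ n - 1 - u ^ p ^ n = -1 by ring, norm_neg, norm_one, norm_pow]
    exact one_lt_pow₀ h (prime_pow_pos n).ne'

theorem one_le_norm_one_sub_pow {u : ℂ_[p]} (hu : 1 ≤ ‖u - 1‖) (n : ℕ) :
    1 ≤ ‖1 - u ^ p ^ n‖ := by
  rw [norm_one_sub_pow hu]
  exact one_le_pow₀ (le_max_left _ _)

theorem one_sub_pow_ne_zero {u : ℂ_[p]} (hu : 1 ≤ ‖u - 1‖) (n : ℕ) : 1 - u ^ p ^ n ≠ 0 :=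
  norm_pos_iff.mp (one_pos.trans_le (one_le_norm_one_sub_pow hu n))

theorem norm_pow_prime_sub_le {x y : ℂ_[p]} (hx : ‖x‖ ≤ 1) (hy : ‖y‖ ≤ 1) :
    ‖x ^ p - y ^ p‖ ≤ ‖x - y‖ * max ‖(p : ℂ_[p])‖ ‖x - y‖ := by
  have hpow : ∀ (z : ℂ_[p]) (i : ℕ), ‖z‖ ≤ 1 → ‖z ^ i‖ ≤ 1 := fun z i hz => by
    rw [norm_pow]; exact pow_le_one₀ (norm_nonneg _) hz
  rw [← (Commute.all x y).geom_sum₂_mul, norm_mul, mul_comm]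
  refine mul_le_mul_of_nonneg_left ?_ (norm_nonneg _)
  have h1 : ∑ i ∈ Finset.range p, x ^ i * y ^ (p - 1 - i) =
      (∑ i ∈ Finset.range p, (x ^ i - y ^ i) * y ^ (p - 1 - i)) + p * y ^ (p - 1) := by
    have h2 : (p : ℂ_[p]) * y ^ (p - 1) =
        ∑ i ∈ Finset.range p, y ^ i * y ^ (p - 1 - i) := by
      rw [Finset.sum_congr rfl (g := fun _ => y ^ (p - 1)), Finset.sum_const, Finset.card_range,
        nsmul_eq_mul]
      intro i hi
      rw [← pow_add]
      congr 1
      have := Finset.mem_range.mp hi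
      omega
    rw [h2, ← Finset.sum_add_distrib]
    exact Finset.sum_congr rfl fun i _ => by ring
  rw [h1]
  refine (IsUltrametricDist.norm_add_le_max _ _).trans (max_le ?_ ?_)
  · refine le_max_of_le_right ?_
    refine IsUltrametricDist.norm_sum_le_of_forall_le_of_nonneg (norm_nonneg _) fun i _ => ?_
    rw [norm_mul, ← (Commute.all x y).geom_sum₂_mul, norm_mul]
    have h3 : ‖∑ j ∈ Finset.range i, x ^ j * y ^ (i - 1 - j)‖ ≤ 1 :=
      IsUltrametricDist.norm_sum_le_of_forall_le_of_nonneg zero_le_one fun j _ => by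
        rw [norm_mul]
        exact mul_le_one₀ (hpow x j hx) (norm_nonneg _) (hpow y _ hy)
    calc _ ≤ 1 * ‖x - y‖ * 1 := by
          gcongr
          exact hpow y _ hy
      _ = _ := by ring
  · refine le_max_of_le_left ?_
    rw [norm_mul]
    exact mul_le_of_le_one_right (norm_nonneg _) (hpow y _ hy)

/-- Iterated `p`-th powers contract residue classes geometrically. -/
theorem norm_pow_prime_pow_sub_le {x y : ℂ_[p]} (hx : ‖x‖ ≤ 1) (hy : ‖y‖ ≤ 1)
    (hxy : ‖x - y‖ ≤ 1) (n : ℕ) :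
    ‖x ^ p ^ n - y ^ p ^ n‖ ≤ max ‖(p : ℂ_[p])‖ ‖x - y‖ ^ (n + 1) := by
  set θ := max ‖(p : ℂ_[p])‖ ‖x - y‖ with hθ
  have hθ0 : 0 ≤ θ := le_max_of_le_left (norm_nonneg _)
  have hθ1 : θ ≤ 1 := max_le norm_prime_lt_one.le hxy
  have hpow : ∀ (z : ℂ_[p]) (i : ℕ), ‖z‖ ≤ 1 → ‖z ^ i‖ ≤ 1 := fun z i hz => by
    rw [norm_pow]; exact pow_le_one₀ (norm_nonneg _) hz
  induction n with
  | zero => simp [hθ]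
  | succ n ih =>
    rw [pow_succ p n, pow_mul, pow_mul]
    refine (norm_pow_prime_sub_le (hpow x _ hx) (hpow y _ hy)).trans ?_
    rw [pow_succ θ (n + 1)]
    refine mul_le_mul ih (max_le (le_max_left _ _) ?_) (le_max_of_le_left (norm_nonneg _))
      (pow_nonneg hθ0 _)
    exact ih.trans (pow_le_of_le_one hθ0 hθ1 (by omega))

theorem tendsto_pow_prime_pow_sub {x y : ℂ_[p]} (hx : ‖x‖ ≤ 1) (hy : ‖y‖ ≤ 1)
    (hxy : ‖x - y‖ < 1) : Tendsto (fun n => x ^ p ^ n - y ^ p ^ n) atTop (𝓝 0) := by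
  refine squeeze_zero_norm (norm_pow_prime_pow_sub_le hx hy hxy.le) ?_
  exact (tendsto_add_atTop_iff_nat 1).mpr <|
    tendsto_pow_atTop_nhds_zero_of_lt_one (le_max_of_le_left (norm_nonneg _))
      (max_lt norm_prime_lt_one hxy)

/-- Since `u ↦ u ^ p ^ l` fixes the residue class of `u` for some `l`, the powers
`u ^ p ^ (α + l k)` form a Cauchy sequence. -/
theorem exists_tendsto_pow_prime_pow (α : ℕ) {u : ℂ_[p]} (hu : ‖u‖ ≤ 1) :
    ∃ L : ℂ_[p], Tendsto (fun n => u ^ p ^ n) (pathFilter α) (𝓝 L) := by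
  obtain ⟨l, hl, h⟩ := exists_norm_pow_sub_lt hu
  set v := u ^ p ^ l with hv
  have hv1 : ‖v‖ ≤ 1 := by
    rw [hv, norm_pow]; exact pow_le_one₀ (norm_nonneg _) hu
  set θ := max ‖(p : ℂ_[p])‖ ‖v - u‖ with hθ
  have hθ0 : 0 ≤ θ := le_max_of_le_left (norm_nonneg _)
  have hθ1 : θ < 1 := max_lt norm_prime_lt_one h
  have hc : CauchySeq (fun k : ℕ => u ^ p ^ (α + l * k)) := by
    refine cauchySeq_of_le_geometric θ 1 hθ1 fun k => ?_
    have h1 : u ^ p ^ (α + l * (k + 1)) = v ^ p ^ (α + l * k) := by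
      rw [hv, ← pow_mul, ← pow_add]
      congr 2
      ring
    rw [h1, dist_comm, dist_eq_norm, one_mul]
    refine (norm_pow_prime_pow_sub_le hv1 hu h.le _).trans ?_
    refine pow_le_pow_of_le_one hθ0 hθ1.le ?_
    nlinarith
  obtain ⟨L, hL⟩ := cauchySeq_tendsto_of_complete hc
  have h2 : Tendsto (fun n => u ^ p ^ n) (map (fun k : ℕ => α + l * k) atTop) (𝓝 L) :=
    tendsto_map'_iff.mpr hL
  exact ⟨L, h2.mono_left (pathFilter_le_map α hl)⟩

/-! ### The line integrals of simple fractions -/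

/-- The limit of `1 / (1 - u ^ pⁿ)` over the levels `n` of the interlocked family: the line
integral of `1 / (y - c)` over the arc `A(a, b)`, where `u = (c - a) / (b - a)`. -/
noncomputable def arcLimit (α : ℕ) (u : ℂ_[p]) : ℂ_[p] :=
  limUnder (pathFilter α) fun n => 1 / (1 - u ^ p ^ n)

theorem arcLimit_eq_of_tendsto {α : ℕ} {u L : ℂ_[p]}
    (h : Tendsto (fun n => 1 / (1 - u ^ p ^ n)) (pathFilter α) (𝓝 L)) : arcLimit α u = L :=
  h.limUnder_eq

theorem tendsto_one_div_one_sub_pow_of_one_lt (α : ℕ) {u : ℂ_[p]} (hu : 1 < ‖u‖) :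
    Tendsto (fun n => 1 / (1 - u ^ p ^ n)) (pathFilter α) (𝓝 0) := by
  refine Tendsto.mono_left ?_ (pathFilter_le_atTop α)
  have hu1 : 1 ≤ ‖u - 1‖ := by
    rw [norm_eq_of_norm_sub_lt (x := u - 1) (y := u) (by simpa using hu)]
    exact hu.le
  have h1 : Tendsto (fun n : ℕ => (‖u‖ ^ p ^ n)⁻¹) atTop (𝓝 0) :=
    ((tendsto_pow_atTop_atTop_of_one_lt hu).comp
      (tendsto_pow_atTop_atTop_of_one_lt (Fact.out : p.Prime).one_lt)).inv_tendsto_atTop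
  refine squeeze_zero_norm (fun n => ?_) h1
  rw [norm_div, norm_one, norm_one_sub_pow hu1, max_eq_right hu.le, one_div]

theorem tendsto_arcLimit (α : ℕ) {u : ℂ_[p]} (hu : 1 ≤ ‖u - 1‖) :
    Tendsto (fun n => 1 / (1 - u ^ p ^ n)) (pathFilter α) (𝓝 (arcLimit α u)) := by
  refine tendsto_nhds_limUnder ?_
  rcases le_or_gt ‖u‖ 1 with h | h
  · obtain ⟨L, hL⟩ := exists_tendsto_pow_prime_pow α h
    have h1 : Tendsto (fun n => 1 - u ^ p ^ n) (pathFilter α) (𝓝 (1 - L)) :=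
      tendsto_const_nhds.sub hL
    have h2 : 1 ≤ ‖1 - L‖ := ge_of_tendsto' h1.norm (one_le_norm_one_sub_pow hu)
    exact ⟨_, tendsto_const_nhds.div h1 (norm_pos_iff.mp (one_pos.trans_le h2))⟩
  · exact ⟨0, tendsto_one_div_one_sub_pow_of_one_lt α h⟩

theorem arcLimit_of_one_lt (α : ℕ) {u : ℂ_[p]} (hu : 1 < ‖u‖) : arcLimit α u = 0 :=
  arcLimit_eq_of_tendsto (tendsto_one_div_one_sub_pow_of_one_lt α hu)

/-- On the closed unit disc, `arcLimit` depends on the residue class only. -/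
theorem arcLimit_congr (α : ℕ) {u v : ℂ_[p]} (hu : ‖u‖ ≤ 1) (hu1 : 1 ≤ ‖u - 1‖)
    (huv : ‖u - v‖ < 1) : arcLimit α u = arcLimit α v := by
  have hv : ‖v‖ ≤ 1 := by
    have := norm_sub_le_max u (u - v)
    rw [sub_sub_cancel] at this
    exact this.trans (max_le hu huv.le)
  have hv1 : 1 ≤ ‖v - 1‖ := by
    rw [norm_eq_of_norm_sub_lt (x := v - 1) (y := u - 1)]
    · exact hu1
    · rw [show v - 1 - (u - 1) = -(u - v) by ring, norm_neg]
      exact huv.trans_le hu1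
  refine tendsto_nhds_unique (tendsto_arcLimit α hu1) ?_
  have h0 : Tendsto (fun n => 1 / (1 - u ^ p ^ n) - 1 / (1 - v ^ p ^ n)) (pathFilter α)
      (𝓝 0) := by
    have hlim := ((tendsto_pow_prime_pow_sub hu hv huv).mono_left (pathFilter_le_atTop α)).norm
    rw [norm_zero] at hlim
    refine squeeze_zero_norm (fun n => ?_) hlim
    have h1 := one_sub_pow_ne_zero hu1 n
    have h2 := one_sub_pow_ne_zero hv1 n
    have h3 : 1 / (1 - u ^ p ^ n) - 1 / (1 - v ^ p ^ n) =
        (u ^ p ^ n - v ^ p ^ n) / ((1 - u ^ p ^ n) * (1 - v ^ p ^ n)) := by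
      field_simp; ring
    rw [h3, norm_div, norm_mul]
    exact div_le_self (norm_nonneg _)
      (one_le_mul_of_one_le_of_one_le (one_le_norm_one_sub_pow hu1 n)
        (one_le_norm_one_sub_pow hv1 n))
  have := h0.add (tendsto_arcLimit α hv1)
  simpa using this

theorem arcLimit_zero (α : ℕ) : arcLimit α (0 : ℂ_[p]) = 1 := by
  refine arcLimit_eq_of_tendsto (tendsto_const_nhds.congr fun n => ?_)
  rw [zero_pow (prime_pow_pos n).ne']; simp

theorem norm_arcLimit_le_one (α : ℕ) {u : ℂ_[p]} (hu : 1 ≤ ‖u - 1‖) : ‖arcLimit α u‖ ≤ 1 :=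
  le_of_tendsto' (tendsto_arcLimit α hu).norm fun n => by
    rw [norm_div, norm_one]
    exact div_le_one_of_le₀ (one_le_norm_one_sub_pow hu n) (norm_nonneg _)

theorem exists_level_arcLimit (α : ℕ) {u : ℂ_[p]} (hu : ‖u‖ ≤ 1) (hu1 : 1 ≤ ‖u - 1‖) :
    ∃ n, ‖1 / (1 - u ^ p ^ n) - arcLimit α u‖ < 1 ∧ ‖u ^ p ^ n - u ^ p ^ α‖ < 1 := by
  obtain ⟨l, hl, h⟩ := exists_norm_pow_sub_lt hu
  let u' : integerRing p := ⟨u, mem_integerRing.mpr hu⟩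
  have hfix : red u' ^ p ^ l = red u' := by
    rw [← map_pow, red_eq_red_iff]; exact h
  have h1 : ∀ k : ℕ, ‖u ^ p ^ (α + l * k) - u ^ p ^ α‖ < 1 := by
    intro k
    have h2 : red (u' ^ p ^ (α + l * k)) = red (u' ^ p ^ α) := by
      rw [map_pow, map_pow]
      induction k with
      | zero => simp
      | succ k ih =>
        rw [← ih, show α + l * (k + 1) = l + (α + l * k) by ring, pow_add p l, pow_mul, hfix]
    exact (red_eq_red_iff _ _).mp h2
  have h2 : ∀ᶠ n in pathFilter α, ‖u ^ p ^ n - u ^ p ^ α‖ < 1 :=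
    pathFilter_le_map α hl (Eventually.of_forall h1 :
      ∀ᶠ k in atTop, ‖u ^ p ^ (α + l * k) - u ^ p ^ α‖ < 1)
  have h3 : ∀ᶠ n in pathFilter α, ‖1 / (1 - u ^ p ^ n) - arcLimit α u‖ < 1 := by
    simpa only [dist_eq_norm] using (Metric.tendsto_nhds.mp (tendsto_arcLimit α hu1)) 1 one_pos
  exact (h3.and h2).exists

/-- Modulo the maximal ideal, `arcLimit α u` is the `α`-fold Frobenius of `1 / (1 - u)`. -/
theorem red_arcLimit (α : ℕ) {u w : integerRing p} (hu1 : 1 ≤ ‖(u : ℂ_[p]) - 1‖)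
    (hw : (w : ℂ_[p]) = arcLimit α (u : ℂ_[p])) : red w * (1 - red u) ^ p ^ α = 1 := by
  obtain ⟨n, h1, h2⟩ := exists_level_arcLimit α (mem_integerRing.mp u.2) hu1
  have hv : ‖1 / (1 - (u : ℂ_[p]) ^ p ^ n)‖ ≤ 1 := by
    rw [norm_div, norm_one]
    exact div_le_one_of_le₀ (one_le_norm_one_sub_pow hu1 n) (norm_nonneg _)
  let v : integerRing p := ⟨_, mem_integerRing.mpr hv⟩
  have hvw : red v = red w := (red_eq_red_iff v w).mpr (by rw [hw]; exact h1)
  have hpow : red u ^ p ^ n = red u ^ p ^ α := by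
    rw [← map_pow, ← map_pow]
    exact (red_eq_red_iff (u ^ p ^ n) (u ^ p ^ α)).mpr h2
  have hmul : v * (1 - u ^ p ^ n) = 1 := by
    ext
    exact div_mul_cancel₀ 1 (one_sub_pow_ne_zero hu1 n)
  rw [← hvw, sub_pow_char_pow, one_pow, ← hpow, ← map_pow, ← map_one red, ← map_sub, ← map_mul,
    hmul]

/-! ### Bounds for means over an arc -/

/-- Cauchy's estimate for a polynomial on the sphere of radius `‖ρ‖`: the coefficients are
averages over roots of unity of an order prime to `p`. -/
theorem norm_coeff_mul_pow_le {P : ℂ_[p][X]} {ε : ℝ} {ρ : ℂ_[p]}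
    (hP : ∀ y : ℂ_[p], ‖y‖ = ‖ρ‖ → ‖P.eval y‖ ≤ ε) (k : ℕ) :
    ‖P.coeff k‖ * ‖ρ‖ ^ k ≤ ε := by
  have hε : 0 ≤ ε := (norm_nonneg _).trans (hP ρ rfl)
  set H := P.comp (C ρ * X) with hH
  have hHk : H.coeff k = P.coeff k * ρ ^ k := by rw [hH, comp_C_mul_X_coeff]
  rw [← norm_pow, ← norm_mul, ← hHk]
  by_cases hk : H.natDegree < k
  · rw [coeff_eq_zero_of_natDegree_lt hk, norm_zero]; exact hε
  set N := p * (H.natDegree + 1) + 1 with hN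
  have hp1 := (Fact.out : p.Prime).one_lt
  have hNd : H.natDegree + 1 < N := by nlinarith
  have hN0 : 0 < N := by omega
  have hNp : ‖(N : ℂ_[p])‖ = 1 := norm_natCast_eq_one_of_not_dvd fun h => by
    rw [hN, Nat.dvd_add_right (dvd_mul_right _ _)] at h
    exact hp1.ne' (Nat.dvd_one.mp h)
  have h1 := mean_pow_mul_eval hN0 (N - k) H
  rw [Finset.sum_eq_single_of_mem k (by simp; omega), if_pos (by
    rw [Nat.sub_add_cancel (by omega)])] at h1
  · rw [← h1, norm_mul, norm_inv, hNp, inv_one, one_mul]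
    refine IsUltrametricDist.norm_sum_le_of_forall_le_of_nonneg hε fun ζ hζ => ?_
    have hζ1 : ‖ζ‖ = 1 := by
      refine (pow_eq_one_iff_of_nonneg (norm_nonneg _) hN0.ne').mp ?_
      rw [← norm_pow, (mem_nthRootsFinset_iff hN0).mp hζ, norm_one]
    rw [norm_mul, norm_pow, hζ1, one_pow, one_mul, hH, eval_comp]
    exact hP _ (by simp [hζ1])
  · intro i hi hik
    have hi := Finset.mem_range.mp hi
    rw [if_neg]
    rintro ⟨d, hd⟩
    rcases d with _ | _ | d
    · omega
    · omega
    · have : N * (d + 1 + 1) = N * d + N + N := by ring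
      have : 0 ≤ N * d := by positivity
      omega

/-- Cauchy's estimate for a polynomial on the open unit disc. -/
theorem norm_coeff_le_of_forall_ball {P : ℂ_[p][X]} {ε : ℝ}
    (hP : ∀ y : ℂ_[p], ‖y‖ < 1 → ‖P.eval y‖ ≤ ε) (k : ℕ) : ‖P.coeff k‖ ≤ ε := by
  -- Radii tending to `1`: the `(m + 1)`-st roots of `p`.
  have h1 : ∀ m : ℕ, ‖P.coeff k‖ * (((p : ℝ)⁻¹) ^ ((1 : ℝ) / ((m : ℝ) + 1))) ^ k ≤ ε := by
    intro m
    obtain ⟨ρ, hρ⟩ := IsAlgClosed.exists_pow_nat_eq (p : ℂ_[p]) (n := m + 1) (by omega)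
    have hρn : ‖ρ‖ ^ (m + 1) = (p : ℝ)⁻¹ := by rw [← norm_pow, hρ, norm_natCast_prime]
    have hρ1 : ‖ρ‖ < 1 := by
      by_contra h
      have := one_le_pow₀ (n := m + 1) (not_lt.mp h)
      rw [← norm_pow, hρ] at this
      exact absurd this norm_prime_lt_one.not_ge
    have : ((p : ℝ)⁻¹) ^ ((1 : ℝ) / ((m : ℝ) + 1)) = ‖ρ‖ := by
      rw [← hρn, one_div]
      exact_mod_cast Real.pow_rpow_inv_natCast (norm_nonneg ρ) (Nat.succ_ne_zero m)
    rw [this]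
    exact norm_coeff_mul_pow_le (fun y hy => hP y (hy ▸ hρ1)) k
  have hp0 : (0 : ℝ) < (p : ℝ)⁻¹ := inv_pos.mpr (by exact_mod_cast (Fact.out : p.Prime).pos)
  have h2 : Tendsto (fun m : ℕ => ‖P.coeff k‖ * (((p : ℝ)⁻¹) ^ ((1 : ℝ) / ((m : ℝ) + 1))) ^ k)
      atTop (𝓝 (‖P.coeff k‖ * (((p : ℝ)⁻¹) ^ (0 : ℝ)) ^ k)) :=
    (((Real.continuousAt_const_rpow hp0.ne').tendsto.comp
      tendsto_one_div_add_atTop_nhds_zero_nat).pow k).const_mul _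
  rw [Real.rpow_zero, one_pow, mul_one] at h2
  exact le_of_tendsto' h2 h1

theorem norm_coeff_mul_le {F G : ℂ_[p][X]} {s t : ℝ} (hF : ∀ i, ‖F.coeff i‖ ≤ s)
    (hG : ∀ i, ‖G.coeff i‖ ≤ t) (i : ℕ) : ‖(F * G).coeff i‖ ≤ s * t := by
  have hs : 0 ≤ s := (norm_nonneg _).trans (hF 0)
  have ht : 0 ≤ t := (norm_nonneg _).trans (hG 0)
  rw [coeff_mul]
  refine IsUltrametricDist.norm_sum_le_of_forall_le_of_nonneg (mul_nonneg hs ht) fun x _ => ?_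
  rw [norm_mul]
  exact mul_le_mul (hF _) (hG _) (norm_nonneg _) hs

/-- On the `pⁿ`-th roots of unity, a simple fraction with its pole `w` off the open unit disc
about `1` agrees with a polynomial whose coefficients are bounded by `‖w - 1‖⁻¹`. -/
theorem exists_poly_eq_inv_sub (n : ℕ) {w : ℂ_[p]} (hw : 1 ≤ ‖w - 1‖) :
    ∃ H : ℂ_[p][X], (∀ i, ‖H.coeff i‖ ≤ ‖w - 1‖⁻¹) ∧
      ∀ ζ : ℂ_[p], ζ ^ p ^ n = 1 → H.eval ζ = (ζ - w)⁻¹ := by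
  have h0 := one_sub_pow_ne_zero hw n
  refine ⟨∑ j ∈ Finset.range (p ^ n), C (w ^ (p ^ n - 1 - j) / (1 - w ^ p ^ n)) * X ^ j,
    fun i => ?_, fun ζ hζ => ?_⟩
  · rw [finsetSum_coeff]
    refine IsUltrametricDist.norm_sum_le_of_forall_le_of_nonneg (by positivity) fun j hj => ?_
    have hj := Finset.mem_range.mp hj
    rw [coeff_C_mul_X_pow]
    split_ifs
    · have hw1 : ‖w - 1‖ ≤ max 1 ‖w‖ := (norm_sub_le_max w 1).trans (by simp [max_comm])
      have hm1 : 1 ≤ max 1 ‖w‖ := le_max_left _ _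
      rw [norm_div, norm_pow, norm_one_sub_pow hw, div_le_iff₀ (by positivity),
        inv_mul_eq_div, le_div_iff₀ (by positivity)]
      calc ‖w‖ ^ (p ^ n - 1 - j) * ‖w - 1‖
          ≤ max 1 ‖w‖ ^ (p ^ n - 1 - j) * max 1 ‖w‖ := by gcongr; exact le_max_right _ _
        _ = max 1 ‖w‖ ^ (p ^ n - 1 - j + 1) := (pow_succ _ _).symm
        _ ≤ _ := pow_le_pow_right₀ hm1 (by omega)
    · rw [norm_zero]; positivity
  · rw [eval_finsetSum]
    have h1 := geom_sum_root_of_unity (u := w) hζ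
    refine eq_inv_of_mul_eq_one_left ?_
    have h3 : ∑ j ∈ Finset.range (p ^ n),
        eval ζ (C (w ^ (p ^ n - 1 - j) / (1 - w ^ p ^ n)) * X ^ j) =
        (∑ j ∈ Finset.range (p ^ n), ζ ^ j * w ^ (p ^ n - 1 - j)) / (1 - w ^ p ^ n) := by
      rw [Finset.sum_div]
      refine Finset.sum_congr rfl fun j _ => ?_
      simp; ring
    rw [h3, div_mul_eq_mul_div, h1, div_self h0]

/-- The reciprocal of a product of linear factors `y - d`, at `y = ζ - 1`. -/
theorem exists_poly_eq_prod_inv_sub (n : ℕ) (S : Multiset ℂ_[p]) (hS : ∀ d ∈ S, 1 ≤ ‖d‖) :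
    ∃ H : ℂ_[p][X], (∀ i, ‖H.coeff i‖ ≤ (S.map fun d => ‖d‖).prod⁻¹) ∧
      ∀ ζ : ℂ_[p], ζ ^ p ^ n = 1 → H.eval ζ = ((S.map fun d => ζ - 1 - d).prod)⁻¹ := by
  induction S using Multiset.induction_on with
  | empty =>
    refine ⟨1, fun i => ?_, fun ζ _ => by simp⟩
    rw [coeff_one]
    split_ifs <;> simp
  | cons d S ih =>
    obtain ⟨H, h1, h2⟩ := ih fun e he => hS e (Multiset.mem_cons_of_mem he)
    obtain ⟨G, h3, h4⟩ := exists_poly_eq_inv_sub n (w := 1 + d) (by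
      rw [add_sub_cancel_left]; exact hS d (Multiset.mem_cons_self d S))
    rw [add_sub_cancel_left] at h3
    refine ⟨G * H, fun i => ?_, fun ζ hζ => ?_⟩
    · rw [Multiset.map_cons, Multiset.prod_cons, mul_inv]
      exact norm_coeff_mul_le h3 h1 i
    · rw [eval_mul, h2 ζ hζ, h4 ζ hζ, Multiset.map_cons, Multiset.prod_cons, mul_inv, sub_sub]

theorem norm_sub_one_lt_of_pow_eq_one {n : ℕ} {ζ : ℂ_[p]} (hζ : ζ ^ p ^ n = 1) : ‖ζ - 1‖ < 1 := by
  by_contra h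
  have h0 := one_sub_pow_ne_zero (u := ζ) (not_lt.mp h) n
  exact h0 (by rw [hζ, sub_self])

theorem norm_mean_mul_eval_le {n : ℕ} {H : ℂ_[p][X]} {ε : ℝ} (hH : ∀ i, ‖H.coeff i‖ ≤ ε) :
    ‖((p ^ n : ℕ) : ℂ_[p])⁻¹ * ∑ ζ ∈ nthRootsFinset (p ^ n) (1 : ℂ_[p]), ζ * H.eval ζ‖ ≤ ε := by
  have hε : 0 ≤ ε := (norm_nonneg _).trans (hH 0)
  have h1 := mean_pow_mul_eval (prime_pow_pos (p := p) n) 1 H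
  simp_rw [pow_one] at h1
  rw [h1]
  refine IsUltrametricDist.norm_sum_le_of_forall_le_of_nonneg hε fun i _ => ?_
  split_ifs
  · exact hH i
  · rwa [norm_zero]

theorem norm_coeff_comp_X_sub_one_le {F : ℂ_[p][X]} {s : ℝ} (hF : ∀ i, ‖F.coeff i‖ ≤ s) (i : ℕ) :
    ‖(F.comp (X - C 1)).coeff i‖ ≤ s := by
  have hs : 0 ≤ s := (norm_nonneg _).trans (hF 0)
  have h1 : ∀ i, ‖(X - C 1 : ℂ_[p][X]).coeff i‖ ≤ 1 := fun i => by
    rw [coeff_sub, coeff_X, coeff_C]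
    refine (norm_sub_le_max _ _).trans (max_le ?_ ?_) <;> split_ifs <;> simp
  have h2 : ∀ m i, ‖((X - C 1 : ℂ_[p][X]) ^ m).coeff i‖ ≤ 1 := fun m => by
    induction m with
    | zero =>
      intro i
      rw [pow_zero, coeff_one]
      split_ifs <;> simp
    | succ m ih =>
      intro i
      rw [pow_succ]
      simpa using norm_coeff_mul_le ih h1 i
  rw [comp_eq_sum_left, Polynomial.sum, finsetSum_coeff]
  refine IsUltrametricDist.norm_sum_le_of_forall_le_of_nonneg hs fun m _ => ?_
  rw [coeff_C_mul, norm_mul]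
  exact (mul_le_of_le_one_right (norm_nonneg _) (h2 m i)).trans (hF m)

theorem norm_prod_map (S : Multiset ℂ_[p]) (f : ℂ_[p] → ℂ_[p]) :
    ‖(S.map f).prod‖ = (S.map fun d => ‖f d‖).prod := by
  induction S using Multiset.induction_on with
  | empty => simp
  | cons d S ih => simp [ih]

/-- In spite of the factor `p⁻ⁿ`, the means of a rational function without poles in the disc of the
arc are bounded, uniformly in the level `n`, by its supremum on the disc. -/
theorem norm_arcMean_rational_le {a b : ℂ_[p]} (hab : b - a ≠ 0) {P Q : ℂ_[p][X]} {ε : ℝ}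
    (hQ : ∀ y ∈ Metric.ball b ‖b - a‖, Q.eval y ≠ 0)
    (h : ∀ y ∈ Metric.ball b ‖b - a‖, ‖P.eval y / Q.eval y‖ ≤ ε) (n : ℕ) :
    ‖arcMean (fun y => P.eval y / Q.eval y) a b n‖ ≤ ‖b - a‖ * ε := by
  have hmem : ∀ y : ℂ_[p], ‖y‖ < 1 → b + (b - a) * y ∈ Metric.ball b ‖b - a‖ := fun y hy => by
    rw [Metric.mem_ball, dist_eq_norm, add_sub_cancel_left, norm_mul]
    exact mul_lt_of_lt_one_right (norm_pos_iff.mpr hab) hy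
  have hb : b ∈ Metric.ball b ‖b - a‖ := Metric.mem_ball_self (norm_pos_iff.mpr hab)
  have hε : 0 ≤ ε := (norm_nonneg _).trans (h b hb)
  -- Rescale the disc of the arc to the open unit disc.
  set P' := P.comp (C b + C (b - a) * X) with hP'
  set Q' := Q.comp (C b + C (b - a) * X) with hQ'
  have hPe : ∀ y, P'.eval y = P.eval (b + (b - a) * y) := fun y => by simp [hP']
  have hQe : ∀ y, Q'.eval y = Q.eval (b + (b - a) * y) := fun y => by simp [hQ']
  have hQ0 : Q' ≠ 0 := fun h0 => hQ b hb (by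
    have := hQe 0
    rw [h0, eval_zero, mul_zero, add_zero] at this
    exact this.symm)
  clear_value P' Q'
  have hroots : ∀ d ∈ Q'.roots, 1 ≤ ‖d‖ := by
    intro d hd
    by_contra hlt
    refine hQ _ (hmem d (not_le.mp hlt)) ?_
    rw [← hQe]
    exact (mem_roots hQ0).mp hd
  have hfac : ∀ y, Q'.eval y = Q'.leadingCoeff * (Q'.roots.map fun d => y - d).prod := by
    intro y
    conv_lhs => rw [(IsAlgClosed.splits Q').eq_prod_roots]
    simp [eval_multiset_prod, Multiset.map_map]
  -- `Q'` has constant absolute value on the open unit disc.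
  set N := ‖Q'.leadingCoeff‖ * (Q'.roots.map fun d => ‖d‖).prod with hN
  have hnorm : ∀ y : ℂ_[p], ‖y‖ < 1 → ‖Q'.eval y‖ = N := by
    intro y hy
    rw [hfac, norm_mul, hN, norm_prod_map]
    congr 2
    refine Multiset.map_congr rfl fun d hd => ?_
    rw [← norm_neg d]
    refine norm_eq_of_norm_sub_lt ?_
    rw [norm_neg, sub_neg_eq_add, sub_add_cancel]
    exact hy.trans_le (hroots d hd)
  have hNpos : 0 < N := by
    rw [← hnorm 0 (by simp), norm_pos_iff, hQe]
    exact hQ _ (hmem 0 (by simp))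
  have hcoeff : ∀ i, ‖P'.coeff i‖ ≤ ε * N := norm_coeff_le_of_forall_ball fun y hy => by
    have := h _ (hmem y hy)
    rwa [← hPe, ← hQe, norm_div, hnorm y hy, div_le_iff₀ hNpos] at this
  have hcoeff' : ∀ i, ‖(P'.comp (X - C 1)).coeff i‖ ≤ ε * N :=
    norm_coeff_comp_X_sub_one_le hcoeff
  obtain ⟨H, hH, hHe⟩ := exists_poly_eq_prod_inv_sub n Q'.roots hroots
  have hlc : Q'.leadingCoeff ≠ 0 := leadingCoeff_ne_zero.mpr hQ0
  have hG : ∀ i, ‖(C (Q'.leadingCoeff⁻¹) * (P'.comp (X - C 1) * H)).coeff i‖ ≤ ε := by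
    intro i
    rw [coeff_C_mul, norm_mul, norm_inv]
    have := norm_coeff_mul_le hcoeff' hH i
    calc _ ≤ ‖Q'.leadingCoeff‖⁻¹ * (ε * N * (Q'.roots.map fun d => ‖d‖).prod⁻¹) := by gcongr
      _ = ε := by
        have h1 : ‖Q'.leadingCoeff‖ ≠ 0 := norm_ne_zero_iff.mpr hlc
        have h2 : (Q'.roots.map fun d => ‖d‖).prod ≠ 0 := fun h0 => by
          rw [hN, h0, mul_zero] at hNpos; exact lt_irrefl _ hNpos
        rw [hN]; field_simp
  rw [arcMean_eq, norm_mul]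
  refine mul_le_mul_of_nonneg_left ?_ (norm_nonneg _)
  refine le_of_eq_of_le ?_ (norm_mean_mul_eval_le (n := n) hG)
  congr 2
  refine Finset.sum_congr rfl fun ζ hζ => ?_
  have hζ := (mem_nthRootsFinset_iff (prime_pow_pos n)).mp hζ
  have hpt : a + (b - a) * ζ = b + (b - a) * (ζ - 1) := by ring
  rw [hpt, ← hPe, ← hQe, hfac, eval_mul, eval_mul, hHe ζ hζ, eval_comp]
  rw [eval_sub, eval_X, eval_C, eval_C]
  rw [div_eq_mul_inv, mul_inv]
  ring

/-- The bound for the means of a Krasner analytic function. -/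
theorem norm_arcMean_le {a b : ℂ_[p]} (hab : b - a ≠ 0) {g : ℂ_[p] → ℂ_[p]} {ε : ℝ}
    (hg : IsKrasnerAnalyticOn g (Metric.ball b ‖b - a‖))
    (h : ∀ y ∈ Metric.ball b ‖b - a‖, ‖g y‖ ≤ ε) (n : ℕ) :
    ‖arcMean g a b n‖ ≤ ‖b - a‖ * ε := by
  obtain ⟨P, Q, hQ, hlim⟩ := hg
  have hmem : ∀ ζ ∈ nthRootsFinset (p ^ n) (1 : ℂ_[p]),
      a + (b - a) * ζ ∈ Metric.ball b ‖b - a‖ := by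
    intro ζ hζ
    have h1 := norm_sub_one_lt_of_pow_eq_one ((mem_nthRootsFinset_iff (prime_pow_pos n)).mp hζ)
    rw [Metric.mem_ball, dist_eq_norm, show a + (b - a) * ζ - b = (b - a) * (ζ - 1) by ring,
      norm_mul]
    exact mul_lt_of_lt_one_right (norm_pos_iff.mpr hab) h1
  have h1 : Tendsto (fun m => arcMean (fun y => (P m).eval y / (Q m).eval y) a b n) atTop
      (𝓝 (arcMean g a b n)) := by
    simp only [arcMean_eq]
    refine ((tendsto_finsetSum _ fun ζ hζ => ?_).const_mul _).const_mul _
    exact (hlim.tendsto_at (hmem ζ hζ)).const_mul _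
  refine le_of_forall_pos_le_add fun δ hδ => ?_
  have hpos : 0 < ‖b - a‖ := norm_pos_iff.mpr hab
  refine le_of_tendsto h1.norm ?_
  filter_upwards [Metric.tendstoUniformlyOn_iff.mp hlim (δ / ‖b - a‖) (by positivity)] with m hm
  refine (norm_arcMean_rational_le hab (hQ m) (ε := ε + δ / ‖b - a‖) ?_ n).trans
    (le_of_eq (by field_simp))
  intro y hy
  have h2 := hm y hy
  rw [dist_comm, dist_eq_norm] at h2
  calc _ = ‖(P m).eval y / (Q m).eval y - g y + g y‖ := by rw [sub_add_cancel]
    _ ≤ _ := norm_add_le _ _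
    _ ≤ _ := by linarith [h y hy]

/-! ### Krasner analytic functions -/

theorem IsKrasnerAnalyticOn.mono {f : ℂ_[p] → ℂ_[p]} {D D' : Set ℂ_[p]}
    (h : IsKrasnerAnalyticOn f D) (hD : D' ⊆ D) : IsKrasnerAnalyticOn f D' := by
  obtain ⟨P, Q, hQ, hlim⟩ := h
  exact ⟨P, Q, fun n x hx => hQ n x (hD hx), hlim.mono hD⟩

theorem isKrasnerAnalyticOn_rational {P Q : ℂ_[p][X]} {D : Set ℂ_[p]}
    (hQ : ∀ x ∈ D, Q.eval x ≠ 0) : IsKrasnerAnalyticOn (fun y => P.eval y / Q.eval y) D := by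
  refine ⟨fun _ => P, fun _ => Q, fun _ => hQ, Metric.tendstoUniformlyOn_iff.mpr fun ε hε => ?_⟩
  exact Eventually.of_forall fun _ x _ => by rwa [dist_self]

theorem IsKrasnerAnalyticOn.sub {f g : ℂ_[p] → ℂ_[p]} {D : Set ℂ_[p]}
    (hf : IsKrasnerAnalyticOn f D) (hg : IsKrasnerAnalyticOn g D) :
    IsKrasnerAnalyticOn (fun y => f y - g y) D := by
  obtain ⟨P, Q, hQ, hlim⟩ := hf
  obtain ⟨P', Q', hQ', hlim'⟩ := hg
  refine ⟨fun n => P n * Q' n - Q n * P' n, fun n => Q n * Q' n, fun n x hx => ?_, ?_⟩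
  · rw [eval_mul]
    exact mul_ne_zero (hQ n x hx) (hQ' n x hx)
  · refine (hlim.sub hlim').congr (Eventually.of_forall fun n x hx => ?_)
    simp only [Pi.sub_apply, eval_sub, eval_mul]
    rw [div_sub_div _ _ (hQ n x hx) (hQ' n x hx)]

/-! ### Combinations of line integrals -/

/-- The discs of a family of arcs `A(A j, B j)`. -/
def arcDiscs {ι : Type*} (A B : ι → ℂ_[p]) : Set ℂ_[p] :=
  ⋃ j, Metric.ball (B j) ‖B j - A j‖

theorem ball_subset_arcDiscs {ι : Type*} (A B : ι → ℂ_[p]) (j : ι) :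
    Metric.ball (B j) ‖B j - A j‖ ⊆ arcDiscs A B :=
  Set.subset_iUnion (fun j => Metric.ball (B j) ‖B j - A j‖) j

variable {ι : Type*} [Fintype ι]

/-- All the line integrals of `g` over the arcs `A(A j, B j)` exist, and their combination with
coefficients `μ j` is `v`. -/
def HasArcSum (α : ℕ) (A B μ : ι → ℂ_[p]) (g : ℂ_[p] → ℂ_[p]) (v : ℂ_[p]) : Prop :=
  ∃ J : ι → ℂ_[p], (∀ j, Tendsto (arcMean g (A j) (B j)) (pathFilter α) (𝓝 (J j))) ∧
    ∑ j, μ j * J j = v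

section

variable {α : ℕ} {A B μ : ι → ℂ_[p]} {f g : ℂ_[p] → ℂ_[p]} {v w : ℂ_[p]}

theorem HasArcSum.add (hf : HasArcSum α A B μ f v) (hg : HasArcSum α A B μ g w) :
    HasArcSum α A B μ (fun y => f y + g y) (v + w) := by
  obtain ⟨J, hJ, rfl⟩ := hf
  obtain ⟨J', hJ', rfl⟩ := hg
  refine ⟨fun j => J j + J' j, fun j => ?_, ?_⟩
  · simpa only [← arcMean_add] using (hJ j).add (hJ' j)
  · rw [← Finset.sum_add_distrib]
    exact Finset.sum_congr rfl fun j _ => mul_add _ _ _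

theorem HasArcSum.const_mul (s : ℂ_[p]) (hf : HasArcSum α A B μ f v) :
    HasArcSum α A B μ (fun y => s * f y) (s * v) := by
  obtain ⟨J, hJ, rfl⟩ := hf
  refine ⟨fun j => s * J j, fun j => ?_, ?_⟩
  · simpa only [← arcMean_const_mul] using (hJ j).const_mul s
  · rw [Finset.mul_sum]
    exact Finset.sum_congr rfl fun j _ => by ring

theorem arcMean_congr {a b : ℂ_[p]} (hab : b - a ≠ 0)
    (h : ∀ y ∈ Metric.ball b ‖b - a‖, f y = g y) (n : ℕ) : arcMean f a b n = arcMean g a b n := by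
  rw [arcMean_eq, arcMean_eq]
  congr 2
  refine Finset.sum_congr rfl fun ζ hζ => ?_
  rw [h _ (by
    have h1 := norm_sub_one_lt_of_pow_eq_one ((mem_nthRootsFinset_iff (prime_pow_pos n)).mp hζ)
    rw [Metric.mem_ball, dist_eq_norm, show a + (b - a) * ζ - b = (b - a) * (ζ - 1) by ring,
      norm_mul]
    exact mul_lt_of_lt_one_right (norm_pos_iff.mpr hab) h1)]

theorem HasArcSum.congr (hAB : ∀ j, B j - A j ≠ 0) (hf : HasArcSum α A B μ f v)
    (h : ∀ y ∈ arcDiscs A B, f y = g y) : HasArcSum α A B μ g v := by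
  obtain ⟨J, hJ, hv⟩ := hf
  exact ⟨J, fun j => (hJ j).congr fun n =>
    arcMean_congr (hAB j) (fun y hy => h y (ball_subset_arcDiscs A B j hy)) n, hv⟩

/-- Line integrals pass to uniform limits of Krasner analytic functions, because the means are
bounded by the supremum uniformly in the level. -/
theorem HasArcSum.of_tendstoUniformlyOn (hAB : ∀ j, B j - A j ≠ 0) {F : ℕ → ℂ_[p] → ℂ_[p]}
    {u : ℕ → ℂ_[p]} (hF : ∀ n, HasArcSum α A B μ (F n) (u n))
    (hFK : ∀ n, IsKrasnerAnalyticOn (F n) (arcDiscs A B))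
    (hgK : IsKrasnerAnalyticOn g (arcDiscs A B))
    (hlim : TendstoUniformlyOn F g atTop (arcDiscs A B)) (hu : Tendsto u atTop (𝓝 v)) :
    HasArcSum α A B μ g v := by
  choose J hJ hv using hF
  have hbound : ∀ j, ∀ ε > 0, ∀ᶠ n in atTop, ∀ m,
      ‖arcMean (F n) (A j) (B j) m - arcMean g (A j) (B j) m‖ ≤ ε := by
    intro j ε hε
    have hpos : 0 < ‖B j - A j‖ := norm_pos_iff.mpr (hAB j)
    filter_upwards [Metric.tendstoUniformlyOn_iff.mp hlim (ε / ‖B j - A j‖) (by positivity)]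
      with n hn m
    rw [← arcMean_sub]
    refine (norm_arcMean_le (hAB j) (((hFK n).sub hgK).mono (ball_subset_arcDiscs A B j))
      (ε := ε / ‖B j - A j‖) (fun y hy => ?_) m).trans (le_of_eq (by field_simp))
    have := hn y (ball_subset_arcDiscs A B j hy)
    rw [dist_comm, dist_eq_norm] at this
    exact this.le
  have hex : ∀ j, ∃ L, Tendsto (arcMean g (A j) (B j)) (pathFilter α) (𝓝 L) := by
    intro j
    refine CompleteSpace.complete (f := map (arcMean g (A j) (B j)) (pathFilter α)) ?_
    refine Metric.cauchy_iff.mpr ⟨inferInstance, fun ε hε => ?_⟩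
    obtain ⟨n, hn⟩ := (hbound j (ε / 4) (by positivity)).exists
    refine ⟨Metric.ball (J n j) (ε / 2), ?_, fun x hx y hy => ?_⟩
    · rw [mem_map]
      filter_upwards [Metric.tendsto_nhds.mp (hJ n j) (ε / 4) (by positivity)] with m hm
      rw [Set.mem_preimage, Metric.mem_ball]
      have h1 := hn m
      rw [← dist_eq_norm, dist_comm] at h1
      linarith [dist_triangle (arcMean g (A j) (B j) m) (arcMean (F n) (A j) (B j) m) (J n j)]
    · have h1 := dist_triangle_right x y (J n j)
      rw [Metric.mem_ball] at hx hy
      linarith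
  choose L hL using hex
  refine ⟨L, hL, ?_⟩
  have hJL : ∀ j, Tendsto (fun n => J n j) atTop (𝓝 (L j)) := by
    intro j
    refine Metric.tendsto_nhds.mpr fun ε hε => ?_
    filter_upwards [hbound j (ε / 2) (by positivity)] with n hn
    rw [dist_eq_norm]
    exact (le_of_tendsto' ((hJ n j).sub (hL j)).norm hn).trans_lt (by linarith)
  have h1 : Tendsto u atTop (𝓝 (∑ j, μ j * L j)) :=
    (tendsto_finsetSum _ fun j _ => (hJL j).const_mul (μ j)).congr fun n => hv n
  exact tendsto_nhds_unique h1 hu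

theorem hasArcSum_polynomial (P : ℂ_[p][X]) : HasArcSum α A B μ (fun y => P.eval y) 0 :=
  ⟨0, fun j => tendsto_arcMean_polynomial α P _ _, by simp⟩

theorem le_norm_sub_one_of_notMem {a b c : ℂ_[p]} (hab : b - a ≠ 0)
    (hc : c ∉ Metric.ball b ‖b - a‖) : 1 ≤ ‖(c - a) / (b - a) - 1‖ := by
  rw [Metric.mem_ball, dist_eq_norm, not_lt] at hc
  rw [show (c - a) / (b - a) - 1 = (c - b) / (b - a) by field_simp; ring, norm_div]
  exact (one_le_div (norm_pos_iff.mpr hab)).mpr hc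

theorem tendsto_arcMean_one_div_sub {a b c : ℂ_[p]} (hab : b - a ≠ 0)
    (hc : c ∉ Metric.ball b ‖b - a‖) :
    Tendsto (arcMean (fun y => 1 / (y - c)) a b) (pathFilter α)
      (𝓝 (arcLimit α ((c - a) / (b - a)))) := by
  have h1 := le_norm_sub_one_of_notMem hab hc
  refine (tendsto_arcLimit α h1).congr fun n => ?_
  exact (arcMean_one_div_sub hab n (sub_ne_zero.mp (one_sub_pow_ne_zero h1 n)).symm).symm

theorem hasArcSum_one_div_sub (hAB : ∀ j, B j - A j ≠ 0) {c : ℂ_[p]} (hc : c ∉ arcDiscs A B) :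
    HasArcSum α A B μ (fun y => 1 / (y - c))
      (∑ j, μ j * arcLimit α ((c - A j) / (B j - A j))) :=
  ⟨_, fun j => tendsto_arcMean_one_div_sub (hAB j) fun h => hc (ball_subset_arcDiscs A B j h), rfl⟩

end

/-! ### Annihilated rational functions -/

/-- The set of poles `c` at positive distance from the arcs at which the combination of line
integrals kills `1 / (y - c)`. -/
def annihilatedPoles (α : ℕ) (A B μ : ι → ℂ_[p]) : Set ℂ_[p] :=
  {c | (∃ δ > 0, ∀ y ∈ arcDiscs A B, δ ≤ ‖y - c‖) ∧
    ∑ j, μ j * arcLimit α ((c - A j) / (B j - A j)) = 0}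

section

variable {α : ℕ} {A B μ : ι → ℂ_[p]}

theorem notMem_arcDiscs_of_mem_annihilatedPoles {c : ℂ_[p]} (hc : c ∈ annihilatedPoles α A B μ) :
    c ∉ arcDiscs A B := by
  obtain ⟨⟨δ, hδ, h⟩, -⟩ := hc
  intro hmem
  have := h c hmem
  rw [sub_self, norm_zero] at this
  linarith

theorem isKrasnerAnalyticOn_prod_inv {D : Set ℂ_[p]} (S : Multiset ℂ_[p]) (hS : ∀ c ∈ S, c ∉ D) :
    IsKrasnerAnalyticOn (fun y => ((S.map fun c => y - c).prod)⁻¹) D := by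
  have h1 : ∀ y, eval y (S.map fun c => X - C c).prod = (S.map fun c => y - c).prod := fun y => by
    simp [eval_multiset_prod, Multiset.map_map]
  have h2 := isKrasnerAnalyticOn_rational (P := 1) (Q := (S.map fun c => X - C c).prod) (D := D)
    fun x hx => by
      rw [h1]
      refine Multiset.prod_ne_zero fun h0 => ?_
      obtain ⟨c, hc, hxc⟩ := Multiset.mem_map.mp h0
      exact hS c hc (sub_eq_zero.mp hxc ▸ hx)
  simpa only [h1, eval_one, one_div] using h2

/-- The resolvent identity
`1 / ((y - c) (y - d)) = (1 / (y - c) - 1 / (y - d)) / (c - d)`. -/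
theorem hasArcSum_prod_inv_of_ne (hAB : ∀ j, B j - A j ≠ 0) {c d : ℂ_[p]} (hcd : c ≠ d)
    {T : Multiset ℂ_[p]} (hc : c ∉ arcDiscs A B) (hd : d ∉ arcDiscs A B)
    (h1 : HasArcSum α A B μ (fun y => (((c ::ₘ T).map fun e => y - e).prod)⁻¹) 0)
    (h2 : HasArcSum α A B μ (fun y => (((d ::ₘ T).map fun e => y - e).prod)⁻¹) 0) :
    HasArcSum α A B μ (fun y => (((c ::ₘ d ::ₘ T).map fun e => y - e).prod)⁻¹) 0 := by
  have h3 := (h1.const_mul (c - d)⁻¹).add (h2.const_mul (-(c - d)⁻¹))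
  rw [mul_zero, mul_zero, add_zero] at h3
  refine h3.congr hAB fun y hy => ?_
  have hyc : y - c ≠ 0 := sub_ne_zero.mpr fun h => hc (h ▸ hy)
  have hyd : y - d ≠ 0 := sub_ne_zero.mpr fun h => hd (h ▸ hy)
  have hcd' : c - d ≠ 0 := sub_ne_zero.mpr hcd
  simp only [Multiset.map_cons, Multiset.prod_cons, mul_inv]
  field_simp
  ring

/-- A combination of line integrals that kills `1 / (y - c)` for all `c` in the open set `E` kills
all products of such fractions: distinct poles are separated by the resolvent identity, and a
multiple pole is a limit of pairs of distinct ones. -/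
theorem hasArcSum_prod_inv (hAB : ∀ j, B j - A j ≠ 0) {E : Set ℂ_[p]} (hE : IsOpen E)
    (hEs : E ⊆ annihilatedPoles α A B μ) (S : Multiset ℂ_[p]) (hS : ∀ c ∈ S, c ∈ E) :
    HasArcSum α A B μ (fun y => ((S.map fun c => y - c).prod)⁻¹) 0 := by
  have hEA : ∀ c ∈ E, c ∉ arcDiscs A B := fun c hc =>
    notMem_arcDiscs_of_mem_annihilatedPoles (hEs hc)
  induction hk : S.card generalizing S with
  | zero =>
    rw [Multiset.card_eq_zero.mp hk]
    simpa using hasArcSum_polynomial (α := α) (A := A) (B := B) (μ := μ) 1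
  | succ k ih =>
    have hne : ∀ (c : ℂ_[p]) (T : Multiset ℂ_[p]), c ∈ E → (∀ d ∈ T, d ∈ E) → T.card = k →
        (∃ d ∈ T, d ≠ c) →
        HasArcSum α A B μ (fun y => (((c ::ₘ T).map fun c => y - c).prod)⁻¹) 0 := by
      rintro c T hc hT hTk ⟨d, hdT, hdc⟩
      obtain ⟨T, rfl⟩ := Multiset.exists_cons_of_mem hdT
      rw [Multiset.card_cons] at hTk
      have hT' : ∀ e ∈ T, e ∈ E := fun e he => hT e (Multiset.mem_cons_of_mem he)
      refine hasArcSum_prod_inv_of_ne hAB hdc.symm (hEA c hc) (hEA d (hT d hdT))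
        (ih _ ?_ (by rw [Multiset.card_cons, hTk])) (ih _ hT (by rw [Multiset.card_cons, hTk]))
      intro e he
      rcases Multiset.mem_cons.mp he with rfl | he
      exacts [hc, hT' e he]
    obtain ⟨c, T, rfl⟩ : ∃ c T, S = c ::ₘ T := by
      obtain ⟨c, hc⟩ := Multiset.card_pos_iff_exists_mem.mp (by omega : 0 < S.card)
      obtain ⟨T, hT⟩ := Multiset.exists_cons_of_mem hc
      exact ⟨c, T, hT⟩
    have hc : c ∈ E := hS c (Multiset.mem_cons_self c T)
    have hT : ∀ d ∈ T, d ∈ E := fun d hd => hS d (Multiset.mem_cons_of_mem hd)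
    rw [Multiset.card_cons, Nat.add_right_cancel_iff] at hk
    by_cases hex : ∃ d ∈ T, d ≠ c
    · exact hne c T hc hT hk hex
    rcases k with _ | k
    · rw [Multiset.card_eq_zero.mp hk]
      have h1 := hasArcSum_one_div_sub (α := α) (μ := μ) hAB (hEA c hc)
      rw [(hEs hc).2] at h1
      simpa using h1
    push Not at hex
    have hT2 : T = Multiset.replicate (k + 1) c := Multiset.eq_replicate.mpr ⟨hk, hex⟩
    obtain ⟨⟨δ, hδ, hδA⟩, -⟩ := hEs hc
    -- Split the multiple pole `c` into `c` and `c + pⁿ`.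
    have hpow : Tendsto (fun n : ℕ => (p : ℂ_[p]) ^ n) atTop (𝓝 0) :=
      tendsto_pow_atTop_nhds_zero_of_norm_lt_one norm_prime_lt_one
    have hev : ∀ᶠ n : ℕ in atTop, c + (p : ℂ_[p]) ^ n ∈ E ∧ ‖(p : ℂ_[p]) ^ n‖ < δ := by
      refine Eventually.and ?_ ?_
      · have : Tendsto (fun n : ℕ => c + (p : ℂ_[p]) ^ n) atTop (𝓝 c) := by
          simpa using hpow.const_add c
        exact this.eventually (hE.mem_nhds hc)
      · have := hpow.norm
        rw [norm_zero] at this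
        exact this.eventually (gt_mem_nhds hδ)
    obtain ⟨n₀, hn₀⟩ := eventually_atTop.mp hev
    set h : ℕ → ℂ_[p] := fun n => (p : ℂ_[p]) ^ (n₀ + n) with hh
    have hhE : ∀ n, c + h n ∈ E := fun n => (hn₀ _ (by omega)).1
    have hhδ : ∀ n, ‖h n‖ < δ := fun n => (hn₀ _ (by omega)).2
    have hh0 : ∀ n, h n ≠ 0 := fun n => pow_ne_zero _ (norm_pos_iff.mp norm_prime_pos)
    have hhlim : Tendsto h atTop (𝓝 0) :=
      hpow.comp (tendsto_atTop_mono (fun n => Nat.le_add_left n n₀) tendsto_id :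
        Tendsto (n₀ + ·) atTop atTop)
    have hmemE : ∀ n, ∀ d ∈ (c + h n) ::ₘ T, d ∈ E := fun n d hd => by
      rcases Multiset.mem_cons.mp hd with rfl | hd
      exacts [hhE n, hT d hd]
    refine HasArcSum.of_tendstoUniformlyOn hAB (u := fun _ => 0)
      (F := fun n y => ((((c + h n) ::ₘ T).map fun c => y - c).prod)⁻¹)
      (fun n => hne (c + h n) T (hhE n) hT hk ⟨c, ?_, ?_⟩)
      (fun n => isKrasnerAnalyticOn_prod_inv _ fun d hd => hEA d (hmemE n d hd))
      (isKrasnerAnalyticOn_prod_inv _ fun d hd => hEA d (hS d hd)) ?_ tendsto_const_nhds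
    · rw [hT2]
      exact Multiset.mem_replicate.mpr ⟨by omega, rfl⟩
    · intro h1
      exact hh0 n (by simpa using h1.symm)
    · refine Metric.tendstoUniformlyOn_iff.mpr fun ε hε => ?_
      have hsmall := hhlim.norm
      rw [norm_zero] at hsmall
      filter_upwards [hsmall.eventually (gt_mem_nhds (by positivity : 0 < ε * δ ^ (k + 3)))]
        with n hn y hy
      have hy1 := hδA y hy
      have hyc : y - c ≠ 0 := norm_pos_iff.mp (hδ.trans_le hy1)
      have hnorm : ‖y - (c + h n)‖ = ‖y - c‖ := by
        refine norm_eq_of_norm_sub_lt ?_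
        rw [show y - (c + h n) - (y - c) = -h n by ring, norm_neg]
        exact (hhδ n).trans_le hy1
      have hyh : y - (c + h n) ≠ 0 := norm_pos_iff.mp (by rw [hnorm]; exact hδ.trans_le hy1)
      have hdiff : (((c ::ₘ T).map fun c => y - c).prod)⁻¹ -
          ((((c + h n) ::ₘ T).map fun c => y - c).prod)⁻¹ =
          -h n / ((y - c) * (y - (c + h n)) * (y - c) ^ (k + 1)) := by
        rw [hT2]
        simp only [Multiset.map_cons, Multiset.prod_cons, Multiset.map_replicate,
          Multiset.prod_replicate]
        field_simp
        ring
      rw [dist_eq_norm, hdiff, norm_div, norm_mul, norm_mul, norm_neg, hnorm,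
        norm_pow (y - c), div_lt_iff₀ (by positivity)]
      refine hn.trans_le (mul_le_mul_of_nonneg_left ?_ hε.le)
      calc δ ^ (k + 3) ≤ ‖y - c‖ ^ (k + 3) := by gcongr
        _ = _ := by ring

/-- Dividing the numerator by one linear factor of the denominator after the other reduces a
rational function to inverses of products of linear factors. -/
theorem hasArcSum_rational (hAB : ∀ j, B j - A j ≠ 0) {E : Set ℂ_[p]} (hE : IsOpen E)
    (hEs : E ⊆ annihilatedPoles α A B μ) (P : ℂ_[p][X]) {Q : ℂ_[p][X]}
    (hQ : ∀ c ∈ Q.roots, c ∈ E) :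
    HasArcSum α A B μ (fun y => P.eval y / Q.eval y) 0 := by
  have key : ∀ (S : Multiset ℂ_[p]), (∀ c ∈ S, c ∈ E) → ∀ P : ℂ_[p][X],
      HasArcSum α A B μ (fun y => P.eval y * ((S.map fun c => y - c).prod)⁻¹) 0 := by
    intro S
    induction S using Multiset.induction_on with
    | empty =>
      intro _ P
      simpa using hasArcSum_polynomial P
    | cons c S ih =>
      intro hS P
      have hc : c ∈ E := hS c (Multiset.mem_cons_self c S)
      have h1 := (hasArcSum_prod_inv hAB hE hEs (c ::ₘ S) hS).const_mul (P.eval c)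
      have h2 := ih (fun d hd => hS d (Multiset.mem_cons_of_mem hd)) (P /ₘ (X - C c))
      have h3 := h1.add h2
      rw [mul_zero, add_zero] at h3
      refine h3.congr hAB fun y hy => ?_
      have hyc : y - c ≠ 0 := sub_ne_zero.mpr fun h =>
        notMem_arcDiscs_of_mem_annihilatedPoles (hEs hc) (h ▸ hy)
      have h4 : P.eval y = P.eval c + (y - c) * (P /ₘ (X - C c)).eval y := by
        conv_lhs => rw [← modByMonic_add_div P (X - C c), modByMonic_X_sub_C_eq_C_eval]
        simp
      rw [h4, Multiset.map_cons, Multiset.prod_cons, mul_inv]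
      field_simp
  have h1 := (key Q.roots hQ P).const_mul (Q.leadingCoeff⁻¹)
  rw [mul_zero] at h1
  refine h1.congr hAB fun y _ => ?_
  have hfac : Q.eval y = Q.leadingCoeff * (Q.roots.map fun d => y - d).prod := by
    conv_lhs => rw [(IsAlgClosed.splits Q).eq_prod_roots]
    simp [eval_multiset_prod, Multiset.map_map]
  rw [hfac, div_eq_mul_inv, mul_inv]
  ring

/-- If the combination of line integrals kills the simple fractions with poles in `E` and
reproduces `1` from `1 / (y - z)`, then it is the Cauchy formula for Krasner analytic functions
on any set `D` that contains `z`, the arcs, and the complement of `E`. -/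
theorem hasArcSum_cauchy (hAB : ∀ j, B j - A j ≠ 0) {E D : Set ℂ_[p]} (hE : IsOpen E)
    (hEs : E ⊆ annihilatedPoles α A B μ) (hED : ∀ c, c ∉ D → c ∈ E) (hD : arcDiscs A B ⊆ D)
    {z : ℂ_[p]} (hz : z ∈ D) {δ : ℝ} (hδ : 0 < δ) (hzδ : ∀ y ∈ arcDiscs A B, δ ≤ ‖y - z‖)
    (hz1 : ∑ j, μ j * arcLimit α ((z - A j) / (B j - A j)) = 1)
    {f : ℂ_[p] → ℂ_[p]} (hf : IsKrasnerAnalyticOn f D) :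
    HasArcSum α A B μ (fun y => f y / (y - z)) (f z) := by
  obtain ⟨P, Q, hQ, hlim⟩ := hf
  have hzA : z ∉ arcDiscs A B := fun h => by
    have := hzδ z h
    rw [sub_self, norm_zero] at this
    linarith
  have hyz : ∀ y ∈ arcDiscs A B, y - z ≠ 0 := fun y hy =>
    sub_ne_zero.mpr fun h => hzA (h ▸ hy)
  set Q' : ℕ → ℂ_[p][X] := fun n => Q n * (X - C z) with hQ'
  have hQ'0 : ∀ n, ∀ y ∈ arcDiscs A B, (Q' n).eval y ≠ 0 := fun n y hy => by
    simpa [hQ'] using ⟨hQ n y (hD hy), hyz y hy⟩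
  have hunif : TendstoUniformlyOn (fun n y => (P n).eval y / (Q' n).eval y)
      (fun y => f y / (y - z)) atTop (arcDiscs A B) := by
    refine Metric.tendstoUniformlyOn_iff.mpr fun ε hε => ?_
    filter_upwards [Metric.tendstoUniformlyOn_iff.mp hlim (ε * δ) (by positivity)] with n hn y hy
    have h1 := hn y (hD hy)
    rw [dist_eq_norm] at h1 ⊢
    have h2 : f y / (y - z) - (P n).eval y / (Q' n).eval y =
        (f y - (P n).eval y / (Q n).eval y) / (y - z) := by
      simp only [hQ', eval_mul, eval_sub, eval_X, eval_C]
      rw [sub_div, div_div]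
    rw [h2, norm_div, div_lt_iff₀ (hδ.trans_le (hzδ y hy))]
    exact h1.trans_le (mul_le_mul_of_nonneg_left (hzδ y hy) hε.le)
  refine HasArcSum.of_tendstoUniformlyOn hAB (u := fun n => (P n).eval z / (Q n).eval z)
    (fun n => ?_) (fun n => isKrasnerAnalyticOn_rational (hQ'0 n)) ⟨P, Q', hQ'0, hunif⟩ hunif
    (hlim.tendsto_at hz)
  -- Split off the pole at `z`.
  set N : ℂ_[p][X] := C ((Q n).eval z) * P n - C ((P n).eval z) * Q n with hN
  have hNz : N.IsRoot z := by simp [hN, IsRoot.def, mul_comm]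
  obtain ⟨G, hG⟩ := dvd_iff_isRoot.mpr hNz
  have hQz := hQ n z hz
  have hQn0 : Q n ≠ 0 := fun h => hQz (by rw [h, eval_zero])
  have h1 := (hasArcSum_rational (μ := μ) (α := α) hAB hE hEs G fun c hc => hED c fun hcD =>
    hQ n c hcD ((mem_roots hQn0).mp hc)).const_mul ((Q n).eval z)⁻¹
  have h2 := (hasArcSum_one_div_sub (α := α) (μ := μ) hAB hzA).const_mul
    ((P n).eval z / (Q n).eval z)
  have h3 := h1.add h2
  rw [hz1, mul_zero, zero_add, mul_one] at h3
  refine h3.congr hAB fun y hy => ?_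
  have h4 := hyz y hy
  have h5 := hQ n y (hD hy)
  have h6 : (Q n).eval z * (P n).eval y - (P n).eval z * (Q n).eval y = (y - z) * G.eval y := by
    have := congrArg (eval y) hG
    simpa [hN] using this
  simp only [hQ', eval_mul, eval_sub, eval_X, eval_C]
  field_simp
  linear_combination -h6

end

/-! ### Cauchy matrices -/

/-- A matrix `D j / (Y j - X i)` is invertible: a vector in its kernel gives a polynomial of degree
less than the number of the nodes `X i` that vanishes at all of them. -/
theorem det_cauchy_ne_zero {k ι : Type*} [Field k] [Fintype ι] [DecidableEq ι] {X' Y D : ι → k}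
    (hX : Function.Injective X') (hY : Function.Injective Y) (hXY : ∀ i j, Y j - X' i ≠ 0)
    (hD : ∀ j, D j ≠ 0) : (Matrix.of fun i j => D j / (Y j - X' i)).det ≠ 0 := by
  intro hdet
  obtain ⟨v, hv0, hv⟩ := Matrix.exists_mulVec_eq_zero_iff.mpr hdet
  set F : k[X] := ∑ j, C (D j * v j) * ∏ l ∈ Finset.univ.erase j, (C (Y l) - X) with hF
  obtain ⟨j, hj⟩ := Function.ne_iff.mp hv0
  have hcard : F.natDegree < Fintype.card ι := by
    have hpos : 0 < Fintype.card ι := Fintype.card_pos_iff.mpr ⟨j⟩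
    refine (natDegree_sum_le_of_forall_le (n := Fintype.card ι - 1) _ _ fun i _ => ?_).trans_lt
      (by omega)
    refine (natDegree_C_mul_le _ _).trans ((natDegree_prod_le _ _).trans ?_)
    refine (Finset.sum_le_card_nsmul _ _ 1 fun l _ => ?_).trans ?_
    · exact (natDegree_sub_le _ _).trans (by simp)
    · rw [Finset.card_erase_of_mem (Finset.mem_univ i), Finset.card_univ]; simp
  have heval : ∀ i, F.eval (X' i) = 0 := by
    intro i
    have h1 := congrFun hv i
    simp only [Matrix.mulVec, dotProduct, Matrix.of_apply, Pi.zero_apply] at h1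
    have h2 : F.eval (X' i) = (∏ l, (Y l - X' i)) * ∑ j, D j / (Y j - X' i) * v j := by
      rw [hF, eval_finsetSum, Finset.mul_sum]
      refine Finset.sum_congr rfl fun l _ => ?_
      rw [← Finset.mul_prod_erase Finset.univ (fun l => Y l - X' i) (Finset.mem_univ l)]
      have := hXY i l
      simp only [eval_mul, eval_C, eval_prod, eval_sub, eval_X]
      field_simp
    rw [h2, h1, mul_zero]
  have hF0 : F = 0 := eq_zero_of_natDegree_lt_card_of_eval_eq_zero F hX heval hcard
  have h3 : F.eval (Y j) = D j * v j * ∏ l ∈ Finset.univ.erase j, (Y l - Y j) := by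
    rw [hF, eval_finsetSum, Finset.sum_eq_single j]
    · simp [eval_prod]
    · intro l _ hlj
      rw [eval_mul, eval_prod, Finset.prod_eq_zero (i := j), mul_zero]
      · exact Finset.mem_erase.mpr ⟨hlj.symm, Finset.mem_univ j⟩
      · simp
    · simp
  rw [hF0, eval_zero] at h3
  refine mul_ne_zero (mul_ne_zero (hD j) hj) (Finset.prod_ne_zero_iff.mpr fun l hl => ?_) h3.symm
  exact sub_ne_zero.mpr fun h => (Finset.mem_erase.mp hl).1 (hY h)

/-- The matrix of the line integrals of simple fractions over arcs of the same radius `R`: modulo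
the maximal ideal it is the `α`-fold Frobenius of the Cauchy matrix
`(B j - A j) / (B j - c i)`. -/
theorem det_arcLimit_ne_zero {ι : Type*} [Fintype ι] [DecidableEq ι] [Nonempty ι] (α : ℕ)
    {A B c : ι → ℂ_[p]} {R : ℝ} (hR : 0 < R) (hAB : ∀ j, ‖B j - A j‖ = R)
    (hcA : ∀ i j, ‖c i - A j‖ ≤ R) (hcB : ∀ i j, R ≤ ‖c i - B j‖)
    (hc : ∀ i i', i ≠ i' → R ≤ ‖c i - c i'‖) (hB : ∀ j j', j ≠ j' → R ≤ ‖B j - B j'‖) :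
    (Matrix.of fun i j => arcLimit α ((c i - A j) / (B j - A j))).det ≠ 0 := by
  obtain ⟨j₀⟩ := ‹Nonempty ι›
  have hAB0 : ∀ j, B j - A j ≠ 0 := fun j => norm_pos_iff.mp ((hAB j).symm ▸ hR)
  set s := B j₀ - A j₀ with hs
  have hs0 : s ≠ 0 := hAB0 j₀
  have hsR : ‖s‖ = R := hAB j₀
  have hcBle : ∀ i j, ‖c i - B j‖ ≤ R := fun i j => by
    have := norm_sub_le_max (c i - A j) (B j - A j)
    rw [sub_sub_sub_cancel_right] at this
    exact this.trans (max_le (hcA i j) (hAB j).le)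
  have hBle : ∀ j, ‖B j - B j₀‖ ≤ R := fun j => by
    have := norm_sub_le_max (c j₀ - B j₀) (c j₀ - B j)
    rw [sub_sub_sub_cancel_left] at this
    exact this.trans (max_le (hcBle _ _) (hcBle _ _))
  have hint : ∀ y : ℂ_[p], ‖y‖ ≤ R → y / s ∈ integerRing p := fun y hy => by
    rw [mem_integerRing, norm_div, hsR]
    exact (div_le_one hR).mpr hy
  let X' : ι → integerRing p := fun i => ⟨(c i - B j₀) / s, hint _ (hcBle i j₀)⟩
  let Y : ι → integerRing p := fun j => ⟨(B j - B j₀) / s, hint _ (hBle j)⟩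
  let D : ι → integerRing p := fun j => ⟨(B j - A j) / s, hint _ (hAB j).le⟩
  have hne : ∀ y : integerRing p, R ≤ ‖(y : ℂ_[p]) * s‖ → red y ≠ 0 := fun y hy h => by
    have h1 := (red_eq_zero_iff y).mp h
    rw [norm_mul, hsR] at hy
    nlinarith
  have hX : Function.Injective fun i => red (X' i) := fun i i' h => by
    by_contra hii
    refine hne (X' i - X' i') ?_ (by rw [map_sub]; exact sub_eq_zero.mpr h)
    refine (hc i i' hii).trans_eq (congrArg norm ?_)
    change c i - c i' = ((c i - B j₀) / s - (c i' - B j₀) / s) * s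
    field_simp; ring
  have hY : Function.Injective fun i => red (Y i) := fun i i' h => by
    by_contra hii
    refine hne (Y i - Y i') ?_ (by rw [map_sub]; exact sub_eq_zero.mpr h)
    refine (hB i i' hii).trans_eq (congrArg norm ?_)
    change B i - B i' = ((B i - B j₀) / s - (B i' - B j₀) / s) * s
    field_simp; ring
  have hXY : ∀ i j, red (Y j) - red (X' i) ≠ 0 := fun i j => by
    rw [← map_sub]
    refine hne _ ?_
    rw [← norm_neg]
    refine (hcB i j).trans_eq (congrArg norm ?_)
    change c i - B j = -(((B j - B j₀) / s - (c i - B j₀) / s) * s)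
    field_simp; ring
  have hD : ∀ j, red (D j) ≠ 0 := fun j => hne _ <| (hAB j).symm.le.trans_eq <| congrArg norm <| by
    change B j - A j = (B j - A j) / s * s
    field_simp
  have hu1 : ∀ i j, 1 ≤ ‖(c i - A j) / (B j - A j) - 1‖ := fun i j => by
    refine le_norm_sub_one_of_notMem (hAB0 j) ?_
    rw [Metric.mem_ball, dist_eq_norm, hAB j, not_lt]
    exact hcB i j
  let N : Matrix ι ι (integerRing p) := Matrix.of fun i j =>
    ⟨arcLimit α ((c i - A j) / (B j - A j)), mem_integerRing.mpr (norm_arcLimit_le_one α (hu1 i j))⟩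
  have hN : (Matrix.of fun i j => arcLimit α ((c i - A j) / (B j - A j))) =
      (integerRing p).subtype.mapMatrix N := by
    ext i j; rfl
  have hred : red.mapMatrix N = (iterateFrobenius (residueField p) p α).mapMatrix
      (Matrix.of fun i j => red (D j) / (red (Y j) - red (X' i))) := by
    ext i j
    have hu : (c i - A j) / (B j - A j) ∈ integerRing p := by
      rw [mem_integerRing, norm_div, hAB j]
      exact (div_le_one hR).mpr (hcA i j)
    let u : integerRing p := ⟨_, hu⟩
    have h1 : red (N i j) * (1 - red u) ^ p ^ α = 1 := red_arcLimit α (hu1 i j) rfl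
    have h2 : (1 - red u) * red (D j) = red (Y j) - red (X' i) := by
      rw [← map_one red, ← map_sub, ← map_mul, ← map_sub]
      congr 1
      ext
      change (1 - (c i - A j) / (B j - A j)) * ((B j - A j) / s) =
        (B j - B j₀) / s - (c i - B j₀) / s
      have := hAB0 j
      field_simp; ring
    have h3 : 1 - red u ≠ 0 := fun h => hXY i j (by rw [← h2, h, zero_mul])
    change red (N i j) =
      iterateFrobenius (residueField p) p α (red (D j) / (red (Y j) - red (X' i)))
    rw [iterateFrobenius_def, ← h2, eq_div_of_mul_eq (pow_ne_zero _ h3) h1,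
      div_mul_cancel_right₀ (hD j), inv_pow, one_div]
  rw [hN, ← RingHom.map_det]
  intro h
  have h1 : N.det = 0 := Subtype.val_injective h
  have h2 : red N.det = 0 := by rw [h1, map_zero]
  rw [RingHom.map_det, hred, ← RingHom.map_det] at h2
  exact det_cauchy_ne_zero hX hY hXY hD ((map_eq_zero _).mp h2)

/-! ### The system of equations for the coefficients -/

/-- The coefficients `μ j` solve the equations of the Cauchy formula: the combination of the line
integrals over the arcs `A(A j, B j)` is `1` for `1 / (y - c 0)` and `0` for `1 / (y - c i)`,
`i ≠ 0`. -/
def IsSolution {M : ℕ} (α : ℕ) (A B c μ : Fin (M + 1) → ℂ_[p]) : Prop :=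
  ∀ i, ∑ j, μ j * arcLimit α ((c i - A j) / (B j - A j)) = if i = 0 then 1 else 0

/-- The equations have a solution if the arcs with index `> m` are so small that their integrals
only see the pole at their own centre, and the other arcs have the same radius. -/
theorem exists_isSolution {M : ℕ} (m α : ℕ) {A B c : Fin (M + 1) → ℂ_[p]} {R : ℝ} (hR : 0 < R)
    (hAB : ∀ j : Fin (M + 1), (j : ℕ) ≤ m → ‖B j - A j‖ = R)
    (hcA : ∀ i j : Fin (M + 1), (i : ℕ) ≤ m → (j : ℕ) ≤ m → ‖c i - A j‖ ≤ R)
    (hcB : ∀ i j : Fin (M + 1), (i : ℕ) ≤ m → (j : ℕ) ≤ m → R ≤ ‖c i - B j‖)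
    (hc : ∀ i i' : Fin (M + 1), (i : ℕ) ≤ m → (i' : ℕ) ≤ m → i ≠ i' → R ≤ ‖c i - c i'‖)
    (hB : ∀ j j' : Fin (M + 1), (j : ℕ) ≤ m → (j' : ℕ) ≤ m → j ≠ j' → R ≤ ‖B j - B j'‖)
    (hsmall : ∀ j : Fin (M + 1), m < (j : ℕ) → c j = A j ∧ 0 < ‖B j - A j‖ ∧
      ∀ i, i ≠ j → ‖B j - A j‖ < ‖c i - A j‖) :
    ∃ μ, IsSolution α A B c μ := by
  set N : Matrix (Fin (M + 1)) (Fin (M + 1)) ℂ_[p] :=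
    Matrix.of fun i j => arcLimit α ((c i - A j) / (B j - A j)) with hN
  have hNs : ∀ i j : Fin (M + 1), m < (j : ℕ) → N i j = if i = j then 1 else 0 := by
    intro i j hj
    obtain ⟨h1, h2, h3⟩ := hsmall j hj
    split_ifs with hij
    · subst hij
      simp [hN, h1, arcLimit_zero]
    · refine arcLimit_of_one_lt α ?_
      rw [norm_div]
      exact (one_lt_div h2).mpr (h3 i hij)
  have hdet : N.det ≠ 0 := by
    rw [Matrix.twoBlockTriangular_det N (fun j => m < (j : ℕ)) (fun i hi j hj => by
      rw [hNs i j hj, if_neg]; rintro rfl; exact hi hj)]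
    refine mul_ne_zero ?_ ?_
    · have : Matrix.toSquareBlockProp N (fun j => m < (j : ℕ)) = 1 := by
        ext i j
        rw [Matrix.toSquareBlockProp_def, Matrix.of_apply, hNs _ _ j.2, Matrix.one_apply]
        simp [Subtype.ext_iff]
      rw [this, Matrix.det_one]
      exact one_ne_zero
    · have hle : ∀ i : {j : Fin (M + 1) // ¬ m < (j : ℕ)}, (i.1 : ℕ) ≤ m := fun i => not_lt.mp i.2
      have : Nonempty {j : Fin (M + 1) // ¬ m < (j : ℕ)} := ⟨⟨0, by simp⟩⟩
      have key := det_arcLimit_ne_zero (ι := {j : Fin (M + 1) // ¬ m < (j : ℕ)})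
        (A := fun j => A j.1) (B := fun j => B j.1) (c := fun j => c j.1) α hR
        (fun j => hAB j.1 (hle j)) (fun i j => hcA i.1 j.1 (hle i) (hle j))
        (fun i j => hcB i.1 j.1 (hle i) (hle j))
        (fun i j h => hc i.1 j.1 (hle i) (hle j) fun h' => h (Subtype.ext h'))
        (fun i j h => hB i.1 j.1 (hle i) (hle j) fun h' => h (Subtype.ext h'))
      have hblock : Matrix.toSquareBlockProp N (fun j => ¬ m < (j : ℕ)) = Matrix.of
          fun i j : {j : Fin (M + 1) // ¬ m < (j : ℕ)} =>
            arcLimit α ((c i.1 - A j.1) / (B j.1 - A j.1)) := rfl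
      rw [hblock]
      convert key
  refine ⟨N⁻¹.mulVec (Pi.single 0 1), fun i => ?_⟩
  have h1 : N.mulVec (N⁻¹.mulVec (Pi.single 0 1)) = Pi.single 0 1 := by
    rw [Matrix.mulVec_mulVec, Matrix.mul_nonsing_inv _ (isUnit_iff_ne_zero.mpr hdet),
      Matrix.one_mulVec]
  have h2 := congrFun h1 i
  rw [Pi.single_apply] at h2
  rw [← h2, Matrix.mulVec, dotProduct]
  exact Finset.sum_congr rfl fun j _ => mul_comm _ _

/-! ### Dependence on the arcs and on the poles -/

/-- The line integral of `1 / (y - c)` over the arc `A(a, b)` does not change if `a` and `b` are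
replaced by points that define the same arc, and `c` by a point whose distance from `c` is less than
the radius or less than the distance of `c` from `a`. -/
theorem arcLimit_perturb (α : ℕ) {a b c a' b' c' : ℂ_[p]} (hab : b - a ≠ 0)
    (ha : ‖a - a'‖ < ‖b - a‖) (hb : ‖b - b'‖ < ‖b - a‖)
    (hc : ‖c - c'‖ < max ‖b - a‖ ‖c - a‖) (hcb : ‖b - a‖ ≤ ‖c - b‖) :
    arcLimit α ((c - a) / (b - a)) = arcLimit α ((c' - a') / (b' - a')) := by
  have hpos : 0 < ‖b - a‖ := norm_pos_iff.mpr hab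
  have hba : ‖(b' - a') - (b - a)‖ < ‖b - a‖ := by
    rw [show (b' - a') - (b - a) = (a - a') - (b - b') by ring]
    exact (norm_sub_le_max _ _).trans_lt (max_lt ha hb)
  have hba' : ‖b' - a'‖ = ‖b - a‖ := norm_eq_of_norm_sub_lt hba
  have hba0 : b' - a' ≠ 0 := norm_pos_iff.mp (hba'.symm ▸ hpos)
  have hca : ‖(c - a) - (c' - a')‖ < max ‖b - a‖ ‖c - a‖ := by
    rw [show (c - a) - (c' - a') = (c - c') - (a - a') by ring]
    exact (norm_sub_le_max _ _).trans_lt (max_lt hc (ha.trans_le (le_max_left _ _)))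
  rcases le_or_gt ‖c - a‖ ‖b - a‖ with h | h
  · rw [max_eq_left h] at hca
    have hu : ‖(c - a) / (b - a)‖ ≤ 1 := by
      rw [norm_div]; exact (div_le_one hpos).mpr h
    refine arcLimit_congr α hu (le_norm_sub_one_of_notMem hab (by
      rw [Metric.mem_ball, dist_eq_norm, not_lt]; exact hcb)) ?_
    have h1 : (c - a) / (b - a) - (c' - a') / (b' - a') =
        (((b' - a') - (b - a)) * ((c - a) / (b - a)) + ((c - a) - (c' - a'))) / (b' - a') := by
      field_simp; ring
    rw [h1, norm_div, hba', div_lt_one hpos]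
    refine (IsUltrametricDist.norm_add_le_max _ _).trans_lt (max_lt ?_ hca)
    rw [norm_mul]
    exact (mul_le_of_le_one_right (norm_nonneg _) hu).trans_lt hba
  · rw [max_eq_right h.le] at hca
    have hca' : ‖c' - a'‖ = ‖c - a‖ := norm_eq_of_norm_sub_lt (by
      rwa [← norm_neg, neg_sub])
    rw [arcLimit_of_one_lt α, arcLimit_of_one_lt α]
    · rw [norm_div, hca', hba']; exact (one_lt_div hpos).mpr h
    · rw [norm_div]; exact (one_lt_div hpos).mpr h

/-! ### Discs with holes -/

/-- The hypotheses of the Cauchy formula on the disc `D⁺(a, R)` with the holes `D⁻(x i, r i)`, the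
boundary arcs `A(a, b)`, `A(x i, bb i)`, and the point `xbar`. The holes with index `< m` have
radius `R`. -/
structure IsCauchyConfig {M : ℕ} (m : ℕ) (R : ℝ) (a b xbar : ℂ_[p]) (x bb : Fin M → ℂ_[p])
    (r : Fin M → ℝ) : Prop where
  R_pos : 0 < R
  one_le : 1 ≤ m
  m_le : m ≤ M
  radius_big : ∀ i : Fin M, (i : ℕ) < m → r i = R
  radius_small : ∀ i : Fin M, m ≤ (i : ℕ) → 0 < r i ∧ r i < R
  center_big : ∀ i : Fin M, (i : ℕ) < m → ‖a - x i‖ = R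
  disjoint_ball : ∀ i j : Fin M, i ≠ j →
    Disjoint (Metric.ball (x i) (r i)) (Metric.ball (x j) (r j))
  disjoint_closedBall : ∀ i j : Fin M, m ≤ (i : ℕ) → m ≤ (j : ℕ) → i ≠ j →
    Disjoint (Metric.closedBall (x i) (r i)) (Metric.closedBall (x j) (r j))
  norm_b_sub_a : ‖b - a‖ = R
  norm_b_sub_x : ∀ i : Fin M, ‖b - x i‖ = R
  norm_bb_sub_x_self : ∀ i : Fin M, ‖bb i - x i‖ = r i
  norm_bb_sub_x : ∀ i j : Fin M, (i : ℕ) < m → ‖bb i - x j‖ = R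
  norm_bb_sub_bb : ∀ i j : Fin M, (i : ℕ) < m → i ≠ j → ‖bb i - bb j‖ = R
  norm_bb_sub_b : ∀ i : Fin M, (i : ℕ) < m → ‖bb i - b‖ = R
  xbar_mem : xbar ∈ holedDisc a R x r
  norm_xbar_sub_b : ‖xbar - b‖ = R
  norm_xbar_sub_bb : ∀ i : Fin M, (i : ℕ) < m → ‖xbar - bb i‖ = R
  lt_norm_xbar_sub_x : ∀ i : Fin M, m ≤ (i : ℕ) → r i < ‖xbar - x i‖

/-- The radius of `D*`, the distance of `xbar` from the centres of the holes. -/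
noncomputable def starRadius {M : ℕ} (xbar : ℂ_[p]) (x : Fin M → ℂ_[p]) : ℝ :=
  ⨅ i : Fin M, ‖xbar - x i‖

theorem norm_sub_le_max_sub (u v w : ℂ_[p]) : ‖u - w‖ ≤ max ‖u - v‖ ‖v - w‖ := by
  simpa only [dist_eq_norm] using dist_triangle_max u v w

theorem norm_sub_eq_of_lt {u v w : ℂ_[p]} (h : ‖u - v‖ < ‖v - w‖) : ‖u - w‖ = ‖v - w‖ :=
  norm_eq_of_norm_sub_lt (by rwa [sub_sub_sub_cancel_right])

theorem le_norm_sub_of_le {u v w : ℂ_[p]} {t : ℝ} (h : ‖u - v‖ < t) (hv : t ≤ ‖v - w‖) :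
    t ≤ ‖u - w‖ := by
  rwa [norm_sub_eq_of_lt (h.trans_le hv)]

theorem mem_holedDisc {M : ℕ} {a y : ℂ_[p]} {R : ℝ} {x : Fin M → ℂ_[p]} {r : Fin M → ℝ} :
    y ∈ holedDisc a R x r ↔ ‖y - a‖ ≤ R ∧ ∀ i, r i ≤ ‖y - x i‖ := by
  simp [holedDisc, dist_eq_norm]

theorem isClosed_holedDisc {M : ℕ} (a : ℂ_[p]) (R : ℝ) (x : Fin M → ℂ_[p]) (r : Fin M → ℝ) :
    IsClosed (holedDisc a R x r) :=
  Metric.isClosed_closedBall.sdiff (isOpen_iUnion fun _ => Metric.isOpen_ball)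

namespace IsCauchyConfig

variable {M m : ℕ} {R : ℝ} {a b xbar : ℂ_[p]} {x bb : Fin M → ℂ_[p]} {r : Fin M → ℝ}

theorem radius_pos (h : IsCauchyConfig m R a b xbar x bb r) (i : Fin M) : 0 < r i := by
  rcases lt_or_ge (i : ℕ) m with hi | hi
  · rw [h.radius_big i hi]; exact h.R_pos
  · exact (h.radius_small i hi).1

theorem radius_le (h : IsCauchyConfig m R a b xbar x bb r) (i : Fin M) : r i ≤ R := by
  rcases lt_or_ge (i : ℕ) m with hi | hi
  · rw [h.radius_big i hi]
  · exact (h.radius_small i hi).2.le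

theorem norm_x_sub_a_le (h : IsCauchyConfig m R a b xbar x bb r) (i : Fin M) : ‖x i - a‖ ≤ R := by
  have := norm_sub_le_max_sub (x i) b a
  rwa [norm_sub_rev (x i) b, h.norm_b_sub_x, h.norm_b_sub_a, max_self] at this

theorem radius_le_norm_x_sub_x (h : IsCauchyConfig m R a b xbar x bb r) {i j : Fin M}
    (hij : i ≠ j) : r j ≤ ‖x i - x j‖ := by
  have := Set.disjoint_left.mp (h.disjoint_ball i j hij) (Metric.mem_ball_self (h.radius_pos i))
  rwa [Metric.mem_ball, dist_eq_norm, not_lt] at this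

theorem radius_lt_norm_x_sub_x (h : IsCauchyConfig m R a b xbar x bb r) {i j : Fin M}
    (hij : i ≠ j) (hj : m ≤ (j : ℕ)) : r j < ‖x i - x j‖ := by
  rcases lt_or_ge (i : ℕ) m with hi | hi
  · have := h.radius_le_norm_x_sub_x hij.symm
    rw [h.radius_big i hi, norm_sub_rev] at this
    exact (h.radius_small j hj).2.trans_le this
  · have := Set.disjoint_left.mp (h.disjoint_closedBall i j hi hj hij)
      (Metric.mem_closedBall_self (h.radius_pos i).le)
    rwa [Metric.mem_closedBall, dist_eq_norm, not_le] at this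

theorem norm_xbar_sub_a_le (h : IsCauchyConfig m R a b xbar x bb r) : ‖xbar - a‖ ≤ R :=
  (mem_holedDisc.mp h.xbar_mem).1

theorem radius_le_norm_xbar_sub_x (h : IsCauchyConfig m R a b xbar x bb r) (i : Fin M) :
    r i ≤ ‖xbar - x i‖ := (mem_holedDisc.mp h.xbar_mem).2 i

theorem norm_xbar_sub_x_le (h : IsCauchyConfig m R a b xbar x bb r) (i : Fin M) :
    ‖xbar - x i‖ ≤ R := by
  refine (norm_sub_le_max_sub xbar a (x i)).trans (max_le h.norm_xbar_sub_a_le ?_)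
  rw [norm_sub_rev]
  exact h.norm_x_sub_a_le i

theorem starRadius_le (x : Fin M → ℂ_[p]) (i : Fin M) : starRadius xbar x ≤ ‖xbar - x i‖ :=
  ciInf_le ⟨0, by rintro _ ⟨i, rfl⟩; exact norm_nonneg _⟩ i

theorem starRadius_pos (h : IsCauchyConfig m R a b xbar x bb r) : 0 < starRadius xbar x := by
  have : Nonempty (Fin M) := ⟨⟨0, h.one_le.trans h.m_le⟩⟩
  obtain ⟨i, hi⟩ := exists_eq_ciInf_of_finite (f := fun i : Fin M => ‖xbar - x i‖)
  rw [starRadius, ← hi]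
  exact (h.radius_pos i).trans_le (h.radius_le_norm_xbar_sub_x i)

theorem starRadius_le_R (h : IsCauchyConfig m R a b xbar x bb r) : starRadius xbar x ≤ R :=
  (starRadius_le x ⟨0, h.one_le.trans h.m_le⟩).trans (h.norm_xbar_sub_x_le _)

theorem norm_arc (h : IsCauchyConfig m R a b xbar x bb r) (j : Fin (M + 1)) :
    ‖(Fin.cons b bb : Fin (M + 1) → ℂ_[p]) j - (Fin.cons a x : Fin (M + 1) → ℂ_[p]) j‖ =
      (Fin.cons R r : Fin (M + 1) → ℝ) j := by
  refine Fin.cases ?_ (fun j => ?_) j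
  · exact h.norm_b_sub_a
  · exact h.norm_bb_sub_x_self j

theorem arc_ne (h : IsCauchyConfig m R a b xbar x bb r) (j : Fin (M + 1)) :
    (Fin.cons b bb : Fin (M + 1) → ℂ_[p]) j - (Fin.cons a x : Fin (M + 1) → ℂ_[p]) j ≠ 0 := by
  rw [← norm_pos_iff, h.norm_arc]
  refine Fin.cases ?_ (fun j => ?_) j
  · exact h.R_pos
  · exact h.radius_pos j

/-- The poles `xbar, x 0, …, x (M - 1)` lie off the arcs. -/
theorem pole_notMem_arc (h : IsCauchyConfig m R a b xbar x bb r) (i j : Fin (M + 1)) :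
    (Fin.cons R r : Fin (M + 1) → ℝ) j ≤ ‖(Fin.cons xbar x : Fin (M + 1) → ℂ_[p]) i -
      (Fin.cons b bb : Fin (M + 1) → ℂ_[p]) j‖ := by
  refine Fin.cases ?_ (fun j => ?_) j <;> refine Fin.cases ?_ (fun i => ?_) i <;>
    simp only [Fin.cons_zero, Fin.cons_succ]
  · exact h.norm_xbar_sub_b.ge
  · rw [norm_sub_rev]; exact (h.norm_b_sub_x i).ge
  · rcases lt_or_ge (j : ℕ) m with hj | hj
    · rw [h.norm_xbar_sub_bb j hj]; exact h.radius_le j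
    · have h1 := h.lt_norm_xbar_sub_x j hj
      rw [norm_sub_rev, norm_sub_eq_of_lt (v := x j)]
      · rw [norm_sub_rev]; exact h1.le
      · rw [h.norm_bb_sub_x_self, norm_sub_rev]; exact h1
  · rcases lt_or_ge (j : ℕ) m with hj | hj
    · rw [norm_sub_rev, h.norm_bb_sub_x j i hj]; exact h.radius_le j
    · by_cases hij : i = j
      · subst hij
        rw [norm_sub_rev]; exact (h.norm_bb_sub_x_self i).ge
      · have h1 := h.radius_lt_norm_x_sub_x hij hj
        rw [norm_sub_rev, norm_sub_eq_of_lt (v := x j)]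
        · rw [norm_sub_rev]; exact h1.le
        · rw [h.norm_bb_sub_x_self, norm_sub_rev]; exact h1

/-- The disc `D*` and the holes are so small that the line integrals of `1 / (y - c)` are constant
as `c` runs through one of them. -/
theorem tolerance_le (h : IsCauchyConfig m R a b xbar x bb r) (i j : Fin (M + 1)) :
    (Fin.cons (starRadius xbar x) r : Fin (M + 1) → ℝ) i ≤ max ((Fin.cons R r : Fin (M + 1) → ℝ) j)
      ‖(Fin.cons xbar x : Fin (M + 1) → ℂ_[p]) i - (Fin.cons a x : Fin (M + 1) → ℂ_[p]) j‖ := by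
  refine Fin.cases ?_ (fun j => ?_) j <;> refine Fin.cases ?_ (fun i => ?_) i <;>
    simp only [Fin.cons_zero, Fin.cons_succ]
  · exact le_max_of_le_left h.starRadius_le_R
  · exact le_max_of_le_left (h.radius_le i)
  · exact le_max_of_le_right (starRadius_le x j)
  · by_cases hij : i = j
    · subst hij; exact le_max_left _ _
    · refine le_max_of_le_right ?_
      rw [norm_sub_rev]
      exact h.radius_le_norm_x_sub_x (Ne.symm hij)

theorem arcDiscs_subset (h : IsCauchyConfig m R a b xbar x bb r) :
    arcDiscs (Fin.cons a x : Fin (M + 1) → ℂ_[p]) (Fin.cons b bb) ⊆ holedDisc a R x r := by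
  refine Set.iUnion_subset fun j y hy => ?_
  rw [h.norm_arc, Metric.mem_ball, dist_eq_norm] at hy
  rw [mem_holedDisc]
  have hB : ∀ i : Fin M, (Fin.cons R r : Fin (M + 1) → ℝ) j ≤
      ‖(Fin.cons b bb : Fin (M + 1) → ℂ_[p]) j - x i‖ := fun i => by
    have := h.pole_notMem_arc i.succ j
    rwa [norm_sub_rev] at this
  revert hy hB
  refine Fin.cases ?_ (fun j => ?_) j <;> simp only [Fin.cons_zero, Fin.cons_succ] <;>
    intro hy hB
  · refine ⟨?_, fun i => (h.radius_le i).trans (le_norm_sub_of_le hy (hB i))⟩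
    exact (norm_sub_le_max_sub y b a).trans (max_le hy.le h.norm_b_sub_a.le)
  · have hyx : ‖y - x j‖ ≤ r j :=
      (norm_sub_le_max_sub y (bb j) (x j)).trans (max_le hy.le (h.norm_bb_sub_x_self j).le)
    refine ⟨?_, fun i => ?_⟩
    · exact (norm_sub_le_max_sub y (x j) a).trans
        (max_le (hyx.trans (h.radius_le j)) (h.norm_x_sub_a_le j))
    · rcases lt_or_ge (j : ℕ) m with hj | hj
      · refine (h.radius_le i).trans ?_
        rw [← h.radius_big j hj]
        exact le_norm_sub_of_le hy (hB i)
      · by_cases hij : i = j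
        · subst hij; exact le_norm_sub_of_le hy (hB i)
        · have h1 := h.radius_lt_norm_x_sub_x hij hj
          rw [norm_sub_rev] at h1
          rw [norm_sub_eq_of_lt (hyx.trans_lt h1)]
          exact h.radius_le_norm_x_sub_x (Ne.symm hij)

theorem ball_subset_holedDisc (h : IsCauchyConfig m R a b xbar x bb r) :
    Metric.ball xbar (starRadius xbar x) ⊆ holedDisc a R x r := by
  intro z hz
  rw [Metric.mem_ball, dist_eq_norm] at hz
  refine mem_holedDisc.mpr ⟨?_, fun i => ?_⟩
  · exact (norm_sub_le_max_sub z xbar a).trans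
      (max_le (hz.le.trans h.starRadius_le_R) h.norm_xbar_sub_a_le)
  · rw [norm_sub_eq_of_lt (hz.trans_le (starRadius_le x i))]
    exact h.radius_le_norm_xbar_sub_x i

theorem exists_isSolution (h : IsCauchyConfig m R a b xbar x bb r) (α : ℕ) :
    ∃ μ, IsSolution α (Fin.cons a x) (Fin.cons b bb) (Fin.cons xbar x) μ := by
  refine PadicLine.exists_isSolution m α h.R_pos ?_ ?_ ?_ ?_ ?_ ?_
  · intro j hj
    rw [h.norm_arc]
    revert hj
    refine Fin.cases ?_ (fun j => ?_) j
    · intro _; rfl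
    · intro hj
      exact h.radius_big j (by simpa [Nat.succ_le_iff] using hj)
  · intro i j hi hj
    revert hi hj
    refine Fin.cases ?_ (fun j => ?_) j <;> refine Fin.cases ?_ (fun i => ?_) i <;>
      simp only [Fin.cons_zero, Fin.cons_succ] <;> intro hi hj
    · exact h.norm_xbar_sub_a_le
    · exact h.norm_x_sub_a_le i
    · exact h.norm_xbar_sub_x_le j
    · refine (norm_sub_le_max_sub _ b _).trans (max_le ?_ (h.norm_b_sub_x j).le)
      rw [norm_sub_rev]; exact (h.norm_b_sub_x i).le
  · intro i j hi hj
    refine le_of_eq_of_le ?_ (h.pole_notMem_arc i j)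
    revert hj
    refine Fin.cases ?_ (fun j => ?_) j
    · intro _; rfl
    · intro hj
      exact (h.radius_big j (by simpa [Nat.succ_le_iff] using hj)).symm
  · intro i i' hi hi'
    revert hi hi'
    refine Fin.cases ?_ (fun j => ?_) i <;> refine Fin.cases ?_ (fun i => ?_) i' <;>
      simp only [Fin.cons_zero, Fin.cons_succ, Fin.val_succ, Nat.succ_le_iff] <;> intro hi hj hij
    · exact absurd rfl hij
    · rw [← h.radius_big i hj]; exact h.radius_le_norm_xbar_sub_x i
    · rw [← h.radius_big j hi, norm_sub_rev]; exact h.radius_le_norm_xbar_sub_x j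
    · rw [← h.radius_big i hj]
      exact h.radius_le_norm_x_sub_x fun h' => hij (by rw [h'])
  · intro j j' hj hj'
    revert hj hj'
    refine Fin.cases ?_ (fun j => ?_) j <;> refine Fin.cases ?_ (fun i => ?_) j' <;>
      simp only [Fin.cons_zero, Fin.cons_succ, Fin.val_succ, Nat.succ_le_iff] <;> intro hi hj hij
    · exact absurd rfl hij
    · rw [norm_sub_rev]; exact (h.norm_bb_sub_b i hj).ge
    · exact (h.norm_bb_sub_b j hi).ge
    · exact (h.norm_bb_sub_bb j i hi fun h' => hij (by rw [h'])).ge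
  · intro j hj
    rw [h.norm_arc]
    revert hj
    refine Fin.cases ?_ (fun j => ?_) j
    · intro hj; simp at hj
    · intro hj
      have hj' : m ≤ (j : ℕ) := by simpa [Nat.lt_succ_iff] using hj
      refine ⟨rfl, h.radius_pos j, fun i => ?_⟩
      refine Fin.cases ?_ (fun i => ?_) i <;> simp only [Fin.cons_zero, Fin.cons_succ] <;> intro hij
      · exact h.lt_norm_xbar_sub_x j hj'
      · exact h.radius_lt_norm_x_sub_x (fun h' => hij (by rw [h'])) hj'

end IsCauchyConfig

/-! ### The coefficients as functions of the discs and arcs -/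

/-- For odd `p`, a circle as a set of points determines its radius. -/
theorem radius_le_of_sphere_eq (hp : p ≠ 2) {a b a' b' : ℂ_[p]}
    (h : Metric.sphere a ‖b - a‖ = Metric.sphere a' ‖b' - a'‖) : ‖b' - a'‖ ≤ ‖b - a‖ := by
  have h2 : ‖((2 : ℕ) : ℂ_[p])‖ = 1 := norm_natCast_eq_one_of_not_dvd fun hdvd =>
    hp ((Nat.prime_dvd_prime_iff_eq Fact.out Nat.prime_two).mp hdvd)
  have hb' : ‖b - a'‖ = ‖b' - a'‖ := by
    have : b ∈ Metric.sphere a' ‖b' - a'‖ := h ▸ (by simp)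
    simpa [dist_eq_norm] using this
  -- The antipode of `b` on the circle; since `2` is a unit, its distance from `b` is the radius.
  have hc : ‖2 * a' - b - a‖ = ‖b - a‖ := by
    have : 2 * a' - b ∈ Metric.sphere a ‖b - a‖ := by
      rw [h, mem_sphere_iff_norm, show 2 * a' - b - a' = -(b - a') by ring, norm_neg, hb']
    exact mem_sphere_iff_norm.mp this
  have h3 := norm_sub_le_max (2 * a' - b - a) (b - a)
  rwa [show 2 * a' - b - a - (b - a) = -(((2 : ℕ) : ℂ_[p]) * (b - a')) by push_cast; ring, norm_neg,
    norm_mul, h2, one_mul, hc, max_self, hb'] at h3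

/-- Points that define the same arc. -/
theorem norm_sub_lt_of_arc_eq (hp : p ≠ 2) {a b a' b' : ℂ_[p]} (hab : b - a ≠ 0)
    (h : arc a b = arc a' b') :
    ‖b' - a'‖ = ‖b - a‖ ∧ ‖a - a'‖ < ‖b - a‖ ∧ ‖b - b'‖ < ‖b - a‖ := by
  have hs : Metric.sphere a ‖b - a‖ = Metric.sphere a' ‖b' - a'‖ := congrArg Arc.circle h
  have hc : Metric.ball b ‖b - a‖ = Metric.ball b' ‖b' - a'‖ := congrArg Arc.carrier h
  have hpos : 0 < ‖b - a‖ := norm_pos_iff.mpr hab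
  have hR : ‖b' - a'‖ = ‖b - a‖ :=
    le_antisymm (radius_le_of_sphere_eq hp hs) (radius_le_of_sphere_eq hp hs.symm)
  rw [hR] at hs hc
  refine ⟨hR, ?_, ?_⟩
  · by_contra hlt
    have hb' : ‖b - a'‖ = ‖b - a‖ := by
      have : b ∈ Metric.sphere a' ‖b - a‖ := hs ▸ (by simp)
      simpa [dist_eq_norm] using this
    have h1 : ‖a - a'‖ ≤ ‖b - a‖ := by
      have := norm_sub_le_max_sub a b a'
      rwa [norm_sub_rev a b, hb', max_self] at this
    have h2 : a ∈ Metric.sphere a ‖b - a‖ := by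
      rw [hs, mem_sphere_iff_norm]
      exact le_antisymm h1 (not_lt.mp hlt)
    rw [mem_sphere_iff_norm, sub_self, norm_zero] at h2
    exact hpos.ne h2
  · have : b ∈ Metric.ball b' ‖b - a‖ := hc ▸ Metric.mem_ball_self hpos
    rwa [Metric.mem_ball, dist_eq_norm] at this

section

variable {M m m' : ℕ} {R R' : ℝ} {a b xbar a' b' xbar' : ℂ_[p]} {x bb x' bb' : Fin M → ℂ_[p]}
  {r r' : Fin M → ℝ}

theorem arcs_cons_eq (ha : arc a b = arc a' b')
    (hx : (fun i => arc (x i) (bb i)) = fun i => arc (x' i) (bb' i)) (j : Fin (M + 1)) :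
    arc ((Fin.cons a x : Fin (M + 1) → ℂ_[p]) j) ((Fin.cons b bb : Fin (M + 1) → ℂ_[p]) j) =
      arc ((Fin.cons a' x' : Fin (M + 1) → ℂ_[p]) j)
        ((Fin.cons b' bb' : Fin (M + 1) → ℂ_[p]) j) := by
  refine Fin.cases ?_ (fun j => ?_) j
  · exact ha
  · exact congrFun hx j

/-- The line integral of `1 / (y - c)` over a boundary arc is constant for `c` in `D*` or in one of
the holes, and it depends on the arc as a set only. -/
theorem IsCauchyConfig.arcLimit_eq (hp : p ≠ 2) {α : ℕ}
    (h : IsCauchyConfig m R a b xbar x bb r)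
    (ha : arc a b = arc a' b') (hx : (fun i => arc (x i) (bb i)) = fun i => arc (x' i) (bb' i))
    {c' : ℂ_[p]} {i : Fin (M + 1)}
    (hc : ‖(Fin.cons xbar x : Fin (M + 1) → ℂ_[p]) i - c'‖ <
      (Fin.cons (starRadius xbar x) r : Fin (M + 1) → ℝ) i) (j : Fin (M + 1)) :
    arcLimit α (((Fin.cons xbar x : Fin (M + 1) → ℂ_[p]) i -
      (Fin.cons a x : Fin (M + 1) → ℂ_[p]) j) / ((Fin.cons b bb : Fin (M + 1) → ℂ_[p]) j -
        (Fin.cons a x : Fin (M + 1) → ℂ_[p]) j)) =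
    arcLimit α ((c' - (Fin.cons a' x' : Fin (M + 1) → ℂ_[p]) j) /
      ((Fin.cons b' bb' : Fin (M + 1) → ℂ_[p]) j -
        (Fin.cons a' x' : Fin (M + 1) → ℂ_[p]) j)) := by
  obtain ⟨-, h1, h2⟩ := norm_sub_lt_of_arc_eq hp (h.arc_ne j) (arcs_cons_eq ha hx j)
  refine arcLimit_perturb α (h.arc_ne j) h1 h2 ?_ ?_
  · rw [h.norm_arc]; exact hc.trans_le (h.tolerance_le i j)
  · rw [h.norm_arc]; exact h.pole_notMem_arc i j

/-- Solutions for one choice of the points that represent `D*` and the arcs are solutions for every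
other choice. -/
theorem IsCauchyConfig.isSolution_congr (hp : p ≠ 2) {α : ℕ}
    (h : IsCauchyConfig m R a b xbar x bb r) (h' : IsCauchyConfig m' R' a' b' xbar' x' bb' r')
    (hD : Metric.ball xbar (starRadius xbar x) = Metric.ball xbar' (starRadius xbar' x'))
    (ha : arc a b = arc a' b') (hx : (fun i => arc (x i) (bb i)) = fun i => arc (x' i) (bb' i))
    {μ : Fin (M + 1) → ℂ_[p]}
    (hμ : IsSolution α (Fin.cons a x) (Fin.cons b bb) (Fin.cons xbar x) μ) :
    IsSolution α (Fin.cons a' x') (Fin.cons b' bb') (Fin.cons xbar' x') μ := by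
  intro i
  rw [← hμ i]
  refine Finset.sum_congr rfl fun j _ => ?_
  rw [h.arcLimit_eq hp ha hx (i := i) (c' := (Fin.cons xbar' x' : Fin (M + 1) → ℂ_[p]) i)]
  refine Fin.cases ?_ (fun i => ?_) i <;> simp only [Fin.cons_zero, Fin.cons_succ]
  · have : xbar' ∈ Metric.ball xbar (starRadius xbar x) :=
      hD ▸ Metric.mem_ball_self h'.starRadius_pos
    rwa [Metric.mem_ball', dist_eq_norm] at this
  · obtain ⟨-, h1, -⟩ := norm_sub_lt_of_arc_eq hp (h.arc_ne i.succ) (arcs_cons_eq ha hx i.succ)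
    rw [h.norm_arc] at h1
    exact h1

/-- The poles of a function that is analytic on the disc with holes are annihilated. -/
theorem IsCauchyConfig.compl_subset_annihilatedPoles (hp : p ≠ 2) {α : ℕ}
    (h : IsCauchyConfig m R a b xbar x bb r) {μ : Fin (M + 1) → ℂ_[p]}
    (hμ : IsSolution α (Fin.cons a x) (Fin.cons b bb) (Fin.cons xbar x) μ) :
    (holedDisc a R x r)ᶜ ⊆ annihilatedPoles α (Fin.cons a x) (Fin.cons b bb) μ := by
  intro c hc
  rw [Set.mem_compl_iff, mem_holedDisc, not_and_or, not_le, not_forall] at hc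
  rcases hc with hc | ⟨i, hi⟩
  · refine ⟨⟨R, h.R_pos, fun y hy => ?_⟩, Finset.sum_eq_zero fun j _ => ?_⟩
    · have hy := (mem_holedDisc.mp (h.arcDiscs_subset hy)).1
      rw [norm_sub_rev c a] at hc
      rw [norm_sub_eq_of_lt (hy.trans_lt hc)]
      exact hc.le
    · rw [arcLimit_of_one_lt, mul_zero]
      have hpos := norm_pos_iff.mpr (h.arc_ne j)
      rw [norm_div, one_lt_div hpos, h.norm_arc]
      refine Fin.cases ?_ (fun j => ?_) j <;> simp only [Fin.cons_zero, Fin.cons_succ]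
      · exact hc
      · have h1 : ‖x j - a‖ < ‖a - c‖ := by
          rw [norm_sub_rev a c]; exact (h.norm_x_sub_a_le j).trans_lt hc
        rw [norm_sub_rev, norm_sub_eq_of_lt h1, norm_sub_rev]
        exact (h.radius_le j).trans_lt hc
  · rw [not_le] at hi
    refine ⟨⟨r i, h.radius_pos i, fun y hy => ?_⟩, ?_⟩
    · have hy := (mem_holedDisc.mp (h.arcDiscs_subset hy)).2 i
      rw [norm_sub_rev] at hi hy ⊢
      exact le_norm_sub_of_le (by rwa [norm_sub_rev]) hy
    · have h1 := hμ i.succ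
      rw [if_neg (Fin.succ_ne_zero i)] at h1
      rw [← h1]
      refine Finset.sum_congr rfl fun j _ => ?_
      rw [h.arcLimit_eq hp rfl rfl (i := i.succ) (c' := c)]
      rw [norm_sub_rev]; exact hi

/-- The Cauchy formula for coefficients that solve the system of equations. -/
theorem IsCauchyConfig.hasArcSum (hp : p ≠ 2) {α : ℕ}
    (h : IsCauchyConfig m R a b xbar x bb r) {μ : Fin (M + 1) → ℂ_[p]}
    (hμ : IsSolution α (Fin.cons a x) (Fin.cons b bb) (Fin.cons xbar x) μ)
    {z : ℂ_[p]} (hz : z ∈ Metric.ball xbar (starRadius xbar x)) {f : ℂ_[p] → ℂ_[p]}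
    (hf : IsKrasnerAnalyticOn f (holedDisc a R x r)) :
    HasArcSum α (Fin.cons a x) (Fin.cons b bb) μ (fun y => f y / (y - z)) (f z) := by
  obtain ⟨j₀, hj₀⟩ := Finite.exists_min (Fin.cons R r : Fin (M + 1) → ℝ)
  have hpos : 0 < (Fin.cons R r : Fin (M + 1) → ℝ) j₀ := by
    rw [← h.norm_arc]; exact norm_pos_iff.mpr (h.arc_ne j₀)
  refine hasArcSum_cauchy h.arc_ne (isClosed_holedDisc a R x r).isOpen_compl
    (h.compl_subset_annihilatedPoles hp hμ) (fun c hc => hc) h.arcDiscs_subset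
    (h.ball_subset_holedDisc hz) hpos (fun y hy => ?_) ?_ hf
  · obtain ⟨j, hj⟩ := Set.mem_iUnion.mp hy
    rw [Metric.mem_ball, dist_eq_norm, h.norm_arc] at hj
    refine (hj₀ j).trans (le_norm_sub_of_le hj ?_)
    have h1 := h.tolerance_le 0 j
    have h2 := h.pole_notMem_arc 0 j
    rw [Metric.mem_ball, dist_eq_norm] at hz
    simp only [Fin.cons_zero] at h1 h2
    rw [norm_sub_rev]
    rcases le_max_iff.mp h1 with h1 | h1
    · exact le_norm_sub_of_le (hz.trans_le h1) h2
    · rcases lt_or_ge ((Fin.cons R r : Fin (M + 1) → ℝ) j)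
        ‖xbar - (Fin.cons a x : Fin (M + 1) → ℂ_[p]) j‖ with h3 | h3
      · have h4 := norm_sub_eq_of_lt (hz.trans_le h1)
        rw [← h4, norm_sub_rev, ← h.norm_arc] at h3
        rw [norm_sub_rev, norm_sub_eq_of_lt h3, ← h.norm_arc]
        exact h3.le
      · exact le_norm_sub_of_le (hz.trans_le (h1.trans h3)) h2
  · have h1 := hμ 0
    rw [if_pos rfl] at h1
    rw [← h1]
    refine Finset.sum_congr rfl fun j _ => ?_
    rw [h.arcLimit_eq hp rfl rfl (i := 0) (c' := z)]
    rwa [Metric.mem_ball', dist_eq_norm] at hz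

end

end PadicLine

/-- Cauchy's integral formula on a closed disc with open holes. The coefficients are a function
`μ` of `α`, the disc `D*`, the domain `D`, the boundary circle, the arc `A(a, b)` and the arcs
`A(x i, b i)` only: they do not depend on `f`, on `z`, or on the points that represent these sets.
The holes are numbered `0, …, M - 1`; those with number `< m` have radius `R`. -/
theorem mainTheorem2 (p : ℕ) [Fact p.Prime] (hp : p ≠ 2) (M : ℕ) :
    ∃ μ : ℕ → Set ℂ_[p] → Set ℂ_[p] → Set ℂ_[p] → PadicLine.Arc p → (Fin M → PadicLine.Arc p) →
        Fin (M + 1) → ℂ_[p],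
      ∀ (α m : ℕ) (R : ℝ) (a b xbar : ℂ_[p]) (x bb : Fin M → ℂ_[p]) (r : Fin M → ℝ),
        0 < R →
        1 ≤ m → m ≤ M →
        (∀ i : Fin M, (i : ℕ) < m → r i = R) →
        (∀ i : Fin M, m ≤ (i : ℕ) → 0 < r i ∧ r i < R) →
        (∀ i : Fin M, (i : ℕ) < m → ‖a - x i‖ = R) →
        (∀ i j : Fin M, i ≠ j → Disjoint (Metric.ball (x i) (r i)) (Metric.ball (x j) (r j))) →
        (∀ i j : Fin M, m ≤ (i : ℕ) → m ≤ (j : ℕ) → i ≠ j →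
          Disjoint (Metric.closedBall (x i) (r i)) (Metric.closedBall (x j) (r j))) →
        ‖b - a‖ = R →
        (∀ i : Fin M, ‖b - x i‖ = R) →
        (∀ i : Fin M, ‖bb i - x i‖ = r i) →
        (∀ i j : Fin M, (i : ℕ) < m → ‖bb i - x j‖ = R) →
        (∀ i j : Fin M, (i : ℕ) < m → i ≠ j → ‖bb i - bb j‖ = R) →
        (∀ i : Fin M, (i : ℕ) < m → ‖bb i - b‖ = R) →
        xbar ∈ PadicLine.holedDisc a R x r →
        ‖xbar - b‖ = R →
        (∀ i : Fin M, (i : ℕ) < m → ‖xbar - bb i‖ = R) →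
        (∀ i : Fin M, m ≤ (i : ℕ) → r i < ‖xbar - x i‖) →
        ∀ z ∈ Metric.ball xbar (⨅ i : Fin M, ‖xbar - x i‖),
        ∀ f : ℂ_[p] → ℂ_[p], PadicLine.IsKrasnerAnalyticOn f (PadicLine.holedDisc a R x r) →
          ∃ I : Fin (M + 1) → ℂ_[p],
            PadicLine.HasLineIntegral (PadicLine.pathFamily α) a b
              (fun y => f y / (y - z)) (I 0) ∧
            (∀ i : Fin M, PadicLine.HasLineIntegral (PadicLine.pathFamily α) (x i) (bb i)
              (fun y => f y / (y - z)) (I i.succ)) ∧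
            f z = ∑ j : Fin (M + 1),
              μ α (Metric.ball xbar (⨅ i : Fin M, ‖xbar - x i‖)) (PadicLine.holedDisc a R x r)
                (Metric.sphere a R) (PadicLine.arc a b) (fun i => PadicLine.arc (x i) (bb i)) j
              * I j := by
  -- The coefficients are chosen to solve the equations for some points that represent the given
  -- sets; they then solve them for all such points.
  refine ⟨fun α Dstar _ _ arc₀ arcs => Classical.epsilon fun μ =>
    ∃ (m : ℕ) (R : ℝ) (a b xbar : ℂ_[p]) (x bb : Fin M → ℂ_[p]) (r : Fin M → ℝ),
      PadicLine.IsCauchyConfig m R a b xbar x bb r ∧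
      Metric.ball xbar (PadicLine.starRadius xbar x) = Dstar ∧ PadicLine.arc a b = arc₀ ∧
      (fun i => PadicLine.arc (x i) (bb i)) = arcs ∧
      PadicLine.IsSolution α (Fin.cons a x) (Fin.cons b bb) (Fin.cons xbar x) μ, ?_⟩
  intro α m R a b xbar x bb r h1 h2 h3 h4 h5 h6 h7 h8 h9 h10 h11 h12 h13 h14 h15 h16 h17 h18
    z hz f hf
  have h : PadicLine.IsCauchyConfig m R a b xbar x bb r :=
    ⟨h1, h2, h3, h4, h5, h6, h7, h8, h9, h10, h11, h12, h13, h14, h15, h16, h17, h18⟩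
  obtain ⟨μ₀, hμ₀⟩ := h.exists_isSolution α
  have hex : ∃ μ : Fin (M + 1) → ℂ_[p],
      ∃ (m' : ℕ) (R' : ℝ) (a' b' xbar' : ℂ_[p]) (x' bb' : Fin M → ℂ_[p]) (r' : Fin M → ℝ),
      PadicLine.IsCauchyConfig m' R' a' b' xbar' x' bb' r' ∧
      Metric.ball xbar' (PadicLine.starRadius xbar' x') =
        Metric.ball xbar (⨅ i : Fin M, ‖xbar - x i‖) ∧
      PadicLine.arc a' b' = PadicLine.arc a b ∧
      (fun i => PadicLine.arc (x' i) (bb' i)) = (fun i => PadicLine.arc (x i) (bb i)) ∧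
      PadicLine.IsSolution α (Fin.cons a' x') (Fin.cons b' bb') (Fin.cons xbar' x') μ :=
    ⟨μ₀, m, R, a, b, xbar, x, bb, r, h, rfl, rfl, rfl, hμ₀⟩
  obtain ⟨m', R', a', b', xbar', x', bb', r', h', hD, ha, hx, hμ'⟩ := Classical.epsilon_spec hex
  obtain ⟨I, hI, hsum⟩ := h.hasArcSum hp (h'.isSolution_congr hp h hD ha hx hμ') hz hf
  exact ⟨I, PadicLine.hasLineIntegral_of_tendsto (hI 0),
    fun i => PadicLine.hasLineIntegral_of_tendsto (hI i.succ), hsum.symm⟩
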